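/- Routing model (fixed port model). $G=(V,E,w)$ is an undirected graph on $V=\{0,\dots,n-1\}$, $n\ge 3$, with nonnegative real edge weights, and $d(u,v)$ denotes the least weight of a path between $u$ and $v$. The links at every vertex $u$ are numbered by ports $0,\dots,\deg(u)-1$ in an arbitrary given order. A preprocessing phase stores at every vertex a bit string, its routing table. A message to $v$ starts at its source with the empty header. At every vertex that holds the message, one computable forwarding algorithm, which is fixed once and for all and does not depend on the graph, $q$ or $\varepsilon$, receives only the routing table of that vertex, the name $v$ and the current header (a bit string). It either delivers the message there, or outputs a new header and a port through which the message is forwarded. Lemma (first routing technique). There are a forwarding algorithm and a constant $C_h$ such that for all $C_0$ and $a_0\in\mathbb N$ there are $C$ and $a\in\mathbb N$ with the following property. Let $G$ be as above with any port numbering, let $\mathcal U=\{U_1,\dots,U_q\}$ be a partition of $V$ into $q$ nonempty sets, each of size at most $C_0\,\frac nq\,(\log n)^{a_0}$ (that is, $\tilde O(n/q)$), and let $\varepsilon>0$. Then there are routing tables, each of at most $$C\Big(\max\{1,\tfrac1\varepsilon\}\,\frac nq+q\Big)(\log n)^{a}$$ bits (that is, $\tilde O(\frac1\varepsilon\frac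 nq+q)$ for $\varepsilon\le 1$), such that for any two vertices $u,v$ in the same set of $\mathcal U$ that are connected by a path in $G$, a message from $u$ to $v$ is delivered at $v$ after traversing a walk of weight at most $(1+\varepsilon)\,d(u,v)$, and every header written on the way has at most $$C_h\Big(\frac1\varepsilon\log n+\frac{\log^2 n}{\log\log n}\Big)$$ bits. -/

import Mathlib

/-- The total weight of a walk (edges are counted with multiplicity). -/
noncomputable def walkWeight {V : Type*} {G : SimpleGraph V} (w : Sym2 V → ℝ) {u v : V}
    (p : G.Walk u v) : ℝ :=
  (p.edges.map w).sum

/-- The weighted distance `d(u, v)`: the least weight of a walk from `u` to `v`. It is used only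
for nonnegative weights and for `v` reachable from `u`. -/
noncomputable def weightedDist {V : Type*} (G : SimpleGraph V) (w : Sym2 V → ℝ) (u v : V) : ℝ :=
  ⨅ p : G.Walk u v, walkWeight w p

/-- A port numbering (fixed port model): the links at each vertex `u` carry the numbers
`0, …, deg u - 1` in an arbitrary order, which the designer of a routing scheme cannot choose. -/
abbrev PortNumbering {V : Type*} (G : SimpleGraph V) : Type _ :=
  (u : V) → G.neighborSet u ≃ Fin (Nat.card (G.neighborSet u))

/-- The local forwarding algorithm. Its whole input is the routing table of the current vertex, the
name of the destination and the current header of the message. It answers `none` (deliver the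
message here) or `some (k, h)` (replace the header by `h` and send the message through port `k`).
It sees nothing else of the graph. -/
abbrev ForwardingAlgorithm : Type :=
  List Bool × ℕ × List Bool → Option (ℕ × List Bool)

/-- `Delivers A P T b v h p`: a message for `v` that is at the first vertex of the walk `p` with
header `h` traverses exactly `p` and is then delivered at `v`, when every vertex `x` runs `A` on
its table `T x`; all headers written on the way have at most `b` bits. -/
inductive Delivers {n : ℕ} {G : SimpleGraph (Fin n)} (A : ForwardingAlgorithm)
    (P : PortNumbering G) (T : Fin n → List Bool) (b : ℝ) (v : Fin n) :
    {u : Fin n} → List Bool → G.Walk u v → Prop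
  | deliver (h : List Bool) (hA : A (T v, (v : ℕ), h) = none) :
      Delivers A P T b v h (SimpleGraph.Walk.nil : G.Walk v v)
  | forward {u x : Fin n} (hux : G.Adj u x) (p : G.Walk x v) (h h' : List Bool)
      (hA : A (T u, (v : ℕ), h) = some ((P u ⟨x, hux⟩ : ℕ), h'))
      (hb : (h'.length : ℝ) ≤ b) (hp : Delivers A P T b v h' p) :
      Delivers A P T b v h (SimpleGraph.Walk.cons hux p)

/-! Let the vicinity of `x` be its `q` closest vertices, ties broken by name. A greedy choice gives
a set `H` of about `(n / q) log n` vertices that meets every vicinity not exhausting its component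
(`exists_hitting_set`). Every vertex stores the next hop to each vertex of its vicinity and, for
each `h ∈ H`, its part of a tree of shortest paths to `h`.

Two kinds of journey need no further information. A vertex `z` in the vicinity of `x` stays in the
vicinity of every vertex on a shortest path from `x` to `z`, so the stored next hops lead there
(`routes_vicinity`). Descending from `h ∈ H` uses preorder intervals, but only for heavy children,
those with more than a fraction `1 / b` of the subtree, where `b` is about `log n`; there are at
most `b` of them. A light edge shrinks the subtree by the factor `b`, so a descent meets at most
`log n / log log n` light edges, and their ports are listed in the header (`exists_routes_tree`).

For the stretch, put `δ = ε d(u,v) / 2`. At `x`, if `v` is in the vicinity, go there. Otherwise some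
`h ∈ H` is in the vicinity. If `d(x,h) ≤ δ`, the route through `h` costs at most `2δ` extra. If not,
follow a shortest path to `v` until it leaves the vicinity; the first vertex outside is at least as
far from `x` as `h`, so more than `δ` has been covered without any loss. This can happen fewer than
`⌈2 / ε⌉` times before `d(u,v)` would be exceeded (`exists_routes_or`).

The whole itinerary is a list of triples (class, target number, port at the target). The source
stores it for every vertex of its own part, whence the `n / q` term with factor `1 / ε`. Class `0`
holds these initial headers, class `1` the vicinities, class `h + 2` the tree of `h`. -/

/-! ### Bit codes and the forwarding algorithm -/

/-- Self-delimiting code of a word: every bit is preceded by `true`, and `false` ends the word. -/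
def encodeWord (w : List Bool) : List Bool := w.flatMap (fun b => [true, b]) ++ [false]

/-- Concatenated codes of a list of words. -/
def encodeWords (l : List (List Bool)) : List Bool := l.flatMap encodeWord

/-- One step of the parser. The state says whether the next bit is a data bit, and holds the current
word and the finished words. -/
def parseStep (s : Bool × List Bool × List (List Bool)) (b : Bool) :
    Bool × List Bool × List (List Bool) :=
  if s.1 = true then (false, s.2.1 ++ [b], s.2.2)
  else if b = true then (true, s.2.1, s.2.2) else (false, [], s.2.2 ++ [s.2.1])

/-- The parser, a left inverse of `encodeWords`. -/
def parseWords (l : List Bool) : List (List Bool) := (l.foldl parseStep (false, [], [])).2.2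

/-- The number with the given binary digits, least significant digit first. -/
def bitsValue (l : List Bool) : ℕ := l.foldr (fun b a => 2 * a + b.toNat) 0

/-- The number in field `i` of a record. -/
def fieldValue (r : List (List Bool)) (i : ℕ) : ℕ := bitsValue (r.getD i [])

theorem length_encodeWord (w : List Bool) : (encodeWord w).length = 2 * w.length + 1 := by
  induction w with
  | nil => rfl
  | cons b w ih => simp only [encodeWord, List.flatMap_cons, List.length_append] at ih ⊢; simp at ih ⊢; omega

theorem length_encodeWords (l : List (List Bool)) :
    (encodeWords l).length = (l.map fun w => 2 * w.length + 1).sum := by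
  simp [encodeWords, List.length_flatMap, length_encodeWord]

theorem foldl_parseStep_encodeWord (w c : List Bool) (o : List (List Bool)) :
    (encodeWord w).foldl parseStep (false, c, o) = (false, [], o ++ [c ++ w]) := by
  induction w generalizing c with
  | nil => simp [encodeWord, parseStep]
  | cons b w ih =>
    have h : encodeWord (b :: w) = true :: b :: encodeWord w := rfl
    simp [h, List.foldl_cons, parseStep] at ih ⊢
    exact (ih _).trans (by simp)

theorem foldl_parseStep_encodeWords (l o : List (List Bool)) :
    (encodeWords l).foldl parseStep (false, [], o) = (false, [], o ++ l) := by
  induction l generalizing o with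
  | nil => simp [encodeWords]
  | cons w l ih =>
    have h : encodeWords (w :: l) = encodeWord w ++ encodeWords l := rfl
    rw [h, List.foldl_append, foldl_parseStep_encodeWord, ih]
    simp

@[simp]
theorem parseWords_encodeWords (l : List (List Bool)) : parseWords (encodeWords l) = l := by
  simp [parseWords, foldl_parseStep_encodeWords]

@[simp]
theorem bitsValue_bits (m : ℕ) : bitsValue m.bits = m := by
  induction m using Nat.binaryRec' with
  | zero => simp [bitsValue]
  | bit b m h ih =>
    rw [Nat.bits_append_bit m b h]
    simp only [bitsValue, List.foldr_cons] at ih ⊢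
    rw [ih]
    cases b <;> simp [Nat.bit]

/-- The first row of the table `T` of class `c` whose interval contains `m`. A row consists of its
class, the ends of its interval, an action and a header. -/
def lookupRow (T : List Bool) (c m : ℕ) : Option (List (List Bool)) :=
  ((parseWords T).filterMap fun r =>
    if fieldValue (parseWords r) 0 = c ∧ fieldValue (parseWords r) 1 ≤ m ∧
      m ≤ fieldValue (parseWords r) 2 then some (parseWords r) else none).head?

/-- The action at a vertex with table `T` on a nonempty header, whose first three words are a class,
a number and a final action. The row found says either how to continue (action `k + 1`: port `k`)
or, with action `0`, that the final action is due. -/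
def routeStep (T h : List Bool) : Option (ℕ × List Bool) :=
  (lookupRow T (fieldValue (parseWords h) 0) (fieldValue (parseWords h) 1)).bind fun r =>
    if fieldValue r 3 = 0 then
      if fieldValue (parseWords h) 2 = 0 then none
      else some (fieldValue (parseWords h) 2 - 1, encodeWords ((parseWords h).drop 3))
    else some (fieldValue r 3 - 1, h)

/-- The header that a message for `v` with header `h` carries effectively at a vertex with table
`T`: an empty header is replaced by the initial header stored in `T`. -/
def effectiveHeader (T : List Bool) (v : ℕ) (h : List Bool) : List Bool :=
  if h = [] then ((lookupRow T 0 v).getD []).getD 4 [] else h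

/-- The forwarding algorithm. -/
def tableForwarding : ForwardingAlgorithm := fun x =>
  routeStep x.1 (effectiveHeader x.1 x.2.1 x.2.2)

/-! ### Computability of the forwarding algorithm -/

section Computability

open Primrec

theorem primrec_encodeWord : Primrec encodeWord := by
  have h : Primrec₂ fun (_ : List Bool) (b : Bool) => [true, b] :=
    (list_cons.comp (const true) (list_cons.comp snd (const []))).to₂
  exact list_append.comp (list_flatMap Primrec.id h) (const [false])

theorem primrec_encodeWords : Primrec encodeWords :=
  list_flatMap Primrec.id (primrec_encodeWord.comp₂ .right)

theorem primrec_parseStep : Primrec₂ parseStep := by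
  refine Primrec.ite (Primrec.eq.comp (fst.comp fst) (const true)) ?_
    (Primrec.ite (Primrec.eq.comp snd (const true)) ?_ ?_)
  · exact (const false).pair ((list_append.comp (fst.comp (snd.comp fst))
      (list_cons.comp snd (const []))).pair (snd.comp (snd.comp fst)))
  · exact (const true).pair ((fst.comp (snd.comp fst)).pair (snd.comp (snd.comp fst)))
  · exact (const false).pair ((const []).pair (list_append.comp (snd.comp (snd.comp fst))
      (list_cons.comp (fst.comp (snd.comp fst)) (const []))))

theorem primrec_parseWords : Primrec parseWords :=
  snd.comp (snd.comp (list_foldl Primrec.id (const _)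
    (primrec_parseStep.comp (fst.comp snd) (snd.comp snd)).to₂))

theorem primrec_bitsValue : Primrec bitsValue := by
  have h : Primrec₂ fun (_ : List Bool) (x : Bool × ℕ) => 2 * x.2 + x.1.toNat :=
    (nat_add.comp (nat_mul.comp (const 2) (snd.comp snd))
      ((dom_bool Bool.toNat).comp (fst.comp snd))).to₂
  exact list_foldr Primrec.id (const 0) h

theorem primrec_fieldValue : Primrec₂ fieldValue :=
  primrec_bitsValue.comp₂ (list_getD [])

theorem primrec_lookupRow :
    Primrec fun x : List Bool × ℕ × ℕ => lookupRow x.1 x.2.1 x.2.2 := by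
  refine list_head?.comp (listFilterMap (primrec_parseWords.comp fst) ?_)
  have hr : Primrec fun y : (List Bool × ℕ × ℕ) × List Bool => parseWords y.2 :=
    primrec_parseWords.comp snd
  have hf (i : ℕ) : Primrec fun y : (List Bool × ℕ × ℕ) × List Bool =>
      fieldValue (parseWords y.2) i := primrec_fieldValue.comp hr (const i)
  exact Primrec.ite ((Primrec.eq.comp (hf 0) (fst.comp (snd.comp fst))).and
    ((nat_le.comp (hf 1) (snd.comp (snd.comp fst))).and
      (nat_le.comp (snd.comp (snd.comp fst)) (hf 2)))) (option_some.comp hr) (const none)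

theorem primrec_routeStep : Primrec₂ routeStep := by
  have hh : Primrec fun y : List Bool × List Bool => parseWords y.2 := primrec_parseWords.comp snd
  have hf (i : ℕ) : Primrec fun y : List Bool × List Bool => fieldValue (parseWords y.2) i :=
    primrec_fieldValue.comp hh (const i)
  refine option_bind (primrec_lookupRow.comp (fst.pair ((hf 0).pair (hf 1)))) ?_
  have hr : Primrec fun z : (List Bool × List Bool) × List (List Bool) => fieldValue z.2 3 :=
    primrec_fieldValue.comp snd (const 3)
  refine Primrec.ite (Primrec.eq.comp hr (const 0))
    (Primrec.ite (Primrec.eq.comp ((hf 2).comp fst) (const 0)) (const none) ?_) ?_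
  · exact option_some.comp ((nat_sub.comp ((hf 2).comp fst) (const 1)).pair
      (primrec_encodeWords.comp (list_drop.comp (const 3) (hh.comp fst))))
  · exact option_some.comp ((nat_sub.comp hr (const 1)).pair (snd.comp fst))

theorem primrec_tableForwarding : Primrec tableForwarding := by
  refine primrec_routeStep.comp fst (Primrec.ite (Primrec.eq.comp (snd.comp snd) (const []))
    ((list_getD []).comp (option_getD.comp (primrec_lookupRow.comp
      (fst.pair ((const 0).pair (fst.comp snd)))) (const [])) (const 4)) (snd.comp snd))

theorem computable_tableForwarding : Computable tableForwarding :=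
  primrec_tableForwarding.to_comp

end Computability

/-! ### Encoded headers and tables -/

/-- The bits of a header made of triples of numbers. -/
def encodeRoute (ρ : List (ℕ × ℕ × ℕ)) : List Bool :=
  encodeWords (ρ.flatMap fun x => [x.1.bits, x.2.1.bits, x.2.2.bits])

/-- The words of a row. -/
def rowWords (r : ℕ × ℕ × ℕ × ℕ × List Bool) : List (List Bool) :=
  [r.1.bits, r.2.1.bits, r.2.2.1.bits, r.2.2.2.1.bits, r.2.2.2.2]

/-- The bits of a table. -/
def encodeTable (R : List (ℕ × ℕ × ℕ × ℕ × List Bool)) : List Bool :=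
  encodeWords (R.map fun r => encodeWords (rowWords r))

/-- The row `r` has class `c`, and its interval contains `m`. -/
def RowMatches (r : ℕ × ℕ × ℕ × ℕ × List Bool) (c m : ℕ) : Prop :=
  r.1 = c ∧ r.2.1 ≤ m ∧ m ≤ r.2.2.1

/-- Which of several matching rows comes first is left open, so the rows may be listed in any order;
`CoreRule.action_eq` shows that the choice does not affect the action. -/
theorem exists_lookupRow_encodeTable {R : List (ℕ × ℕ × ℕ × ℕ × List Bool)} {c m : ℕ}
    (h : ∃ r ∈ R, RowMatches r c m) :
    ∃ r ∈ R, RowMatches r c m ∧ lookupRow (encodeTable R) c m = some (rowWords r) := by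
  classical
  induction R with
  | nil => simp at h
  | cons r R ih =>
    by_cases hr : RowMatches r c m
    · refine ⟨r, by simp, hr, ?_⟩
      simp [lookupRow, encodeTable, fieldValue, rowWords]
      have := hr
      simp only [RowMatches] at this
      simp [this]
    · obtain ⟨r', h1, h2, h3⟩ := ih (by
        obtain ⟨r', h1, h2⟩ := h
        rcases List.mem_cons.1 h1 with rfl | h1
        · exact absurd h2 hr
        · exact ⟨r', h1, h2⟩)
      refine ⟨r', by simp [h1], h2, ?_⟩
      rw [← h3]
      simp only [RowMatches] at hr
      simp [lookupRow, encodeTable, fieldValue, rowWords, hr]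

theorem encodeRoute_cons (x : ℕ × ℕ × ℕ) (ρ : List (ℕ × ℕ × ℕ)) :
    encodeRoute (x :: ρ) =
      encodeWord x.1.bits ++ (encodeWord x.2.1.bits ++ (encodeWord x.2.2.bits ++ encodeRoute ρ)) := by
  simp [encodeRoute, encodeWords]

/-- The empty header is reserved for the start of a journey, so a header with entries left must
never be mistaken for it. -/
theorem encodeRoute_cons_ne_nil (x : ℕ × ℕ × ℕ) (ρ : List (ℕ × ℕ × ℕ)) :
    encodeRoute (x :: ρ) ≠ [] := by
  rw [encodeRoute_cons]
  simp [encodeWord]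

theorem length_encodeRoute_le_cons (x : ℕ × ℕ × ℕ) (ρ : List (ℕ × ℕ × ℕ)) :
    (encodeRoute ρ).length ≤ (encodeRoute (x :: ρ)).length := by
  rw [encodeRoute_cons]
  simp
  omega

theorem length_encodeRoute_le {ρ : List (ℕ × ℕ × ℕ)} {N : ℕ}
    (h : ∀ x ∈ ρ, x.1 ≤ N ∧ x.2.1 ≤ N ∧ x.2.2 ≤ N) :
    (encodeRoute ρ).length ≤ ρ.length * (3 * (2 * N.size + 1)) := by
  induction ρ with
  | nil => simp [encodeRoute, encodeWords]
  | cons x ρ ih =>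
    have h1 := ih fun y hy => h y (by simp [hy])
    obtain ⟨h2, h3, h4⟩ := h x (by simp)
    rw [encodeRoute_cons]
    simp only [List.length_append, length_encodeWord, Nat.size_eq_bits_len, List.length_cons]
    have := Nat.size_le_size h2
    have := Nat.size_le_size h3
    have := Nat.size_le_size h4
    rw [Nat.add_mul]
    omega

theorem routeStep_encodeRoute_cons {T : List Bool} {c m k : ℕ} {ρ : List (ℕ × ℕ × ℕ)}
    {r : List (List Bool)} (h : lookupRow T c m = some r) :
    routeStep T (encodeRoute ((c, m, k) :: ρ)) =
      if fieldValue r 3 = 0 then if k = 0 then none else some (k - 1, encodeRoute ρ)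
      else some (fieldValue r 3 - 1, encodeRoute ((c, m, k) :: ρ)) := by
  simp [routeStep, encodeRoute, fieldValue, h]

theorem tableForwarding_of_ne_nil (T : List Bool) (v : ℕ) {h : List Bool} (hh : h ≠ []) :
    tableForwarding (T, v, h) = routeStep T h := by
  simp [tableForwarding, effectiveHeader, hh]

theorem length_encodeTable_le {R : List (ℕ × ℕ × ℕ × ℕ × List Bool)} {N : ℕ}
    (h : ∀ r ∈ R, r.1 ≤ N ∧ r.2.1 ≤ N ∧ r.2.2.1 ≤ N ∧ r.2.2.2.1 ≤ N) :
    (encodeTable R).length ≤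
      (R.map fun r => 2 * (4 * (2 * N.size + 1) + (2 * r.2.2.2.2.length + 1)) + 1).sum := by
  rw [encodeTable, length_encodeWords, List.map_map]
  refine List.sum_le_sum fun r hr => ?_
  obtain ⟨h1, h2, h3, h4⟩ := h r hr
  have := Nat.size_le_size h1
  have := Nat.size_le_size h2
  have := Nat.size_le_size h3
  have := Nat.size_le_size h4
  simp only [Function.comp, length_encodeWords, rowWords, List.map_cons, List.map_nil,
    List.sum_cons, List.sum_nil, Nat.size_eq_bits_len]
  omega

/-! ### Weighted distance and next hops -/

section Distance

variable {V : Type*} {G : SimpleGraph V} {w : Sym2 V → ℝ}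

theorem walkWeight_cons {u v x : V} (h : G.Adj u v) (p : G.Walk v x) :
    walkWeight w (SimpleGraph.Walk.cons h p) = w s(u, v) + walkWeight w p := by
  simp [walkWeight]

theorem walkWeight_append {u v x : V} (p : G.Walk u v) (p' : G.Walk v x) :
    walkWeight w (p.append p') = walkWeight w p + walkWeight w p' := by
  simp [walkWeight, SimpleGraph.Walk.edges_append]

theorem walkWeight_reverse {u v : V} (p : G.Walk u v) :
    walkWeight w p.reverse = walkWeight w p := by
  simp [walkWeight, List.sum_reverse]

theorem walkWeight_nonneg (hw : ∀ e ∈ G.edgeSet, 0 ≤ w e) {u v : V} (p : G.Walk u v) :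
    0 ≤ walkWeight w p := by
  refine List.sum_nonneg fun x hx => ?_
  obtain ⟨e, he, rfl⟩ := List.mem_map.1 hx
  exact hw e (p.edges_subset_edgeSet he)

theorem weightedDist_le (hw : ∀ e ∈ G.edgeSet, 0 ≤ w e) {u v : V} (p : G.Walk u v) :
    weightedDist G w u v ≤ walkWeight w p :=
  ciInf_le ⟨0, by rintro _ ⟨p, rfl⟩; exact walkWeight_nonneg hw p⟩ p

theorem weightedDist_nonneg (hw : ∀ e ∈ G.edgeSet, 0 ≤ w e) (u v : V) :
    0 ≤ weightedDist G w u v :=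
  Real.iInf_nonneg fun p => walkWeight_nonneg hw p

theorem walkWeight_bypass_le [DecidableEq V] (hw : ∀ e ∈ G.edgeSet, 0 ≤ w e) {u v : V}
    (p : G.Walk u v) : walkWeight w p.bypass ≤ walkWeight w p := by
  refine List.Sublist.sum_le_sum (p.edges_bypass_sublist_edges.map w) fun x hx => ?_
  obtain ⟨e, he, rfl⟩ := List.mem_map.1 hx
  exact hw e (p.edges_subset_edgeSet he)

/-- There are finitely many paths, and cutting the loops out of a walk does not increase its weight.
-/
theorem exists_walkWeight_eq_weightedDist [Fintype V] (hw : ∀ e ∈ G.edgeSet, 0 ≤ w e) {u v : V}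
    (h : G.Reachable u v) : ∃ p : G.Walk u v, walkWeight w p = weightedDist G w u v := by
  classical
  obtain ⟨p₀⟩ := h
  have : Nonempty (G.Walk u v) := ⟨p₀⟩
  have : Nonempty (G.Path u v) := ⟨p₀.toPath⟩
  obtain ⟨p, hp⟩ := Finite.exists_min fun p : G.Path u v => walkWeight w p.1
  refine ⟨p.1, le_antisymm (le_ciInf fun p' => ?_) (weightedDist_le hw _)⟩
  exact (hp p'.toPath).trans (walkWeight_bypass_le hw p')

theorem weightedDist_comm (G : SimpleGraph V) (w : Sym2 V → ℝ) (u v : V) :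
    weightedDist G w u v = weightedDist G w v u :=
  Equiv.iInf_congr ⟨SimpleGraph.Walk.reverse, SimpleGraph.Walk.reverse,
    fun p => p.reverse_reverse, fun p => p.reverse_reverse⟩ fun p => walkWeight_reverse p

theorem weightedDist_triangle [Fintype V] (hw : ∀ e ∈ G.edgeSet, 0 ≤ w e) {u v x : V}
    (h : G.Reachable u v) (h' : G.Reachable v x) :
    weightedDist G w u x ≤ weightedDist G w u v + weightedDist G w v x := by
  obtain ⟨p, hp⟩ := exists_walkWeight_eq_weightedDist hw h
  obtain ⟨p', hp'⟩ := exists_walkWeight_eq_weightedDist hw h'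
  rw [← hp, ← hp', ← walkWeight_append]
  exact weightedDist_le hw _

theorem weightedDist_self (hw : ∀ e ∈ G.edgeSet, 0 ≤ w e) (u : V) :
    weightedDist G w u u = 0 :=
  le_antisymm (weightedDist_le hw (SimpleGraph.Walk.nil : G.Walk u u)) (weightedDist_nonneg hw u u)

theorem weightedDist_le_of_adj (hw : ∀ e ∈ G.edgeSet, 0 ≤ w e) {u v : V} (h : G.Adj u v) :
    weightedDist G w u v ≤ w s(u, v) := by
  simpa [walkWeight] using weightedDist_le hw h.toWalk

/-- The least number of edges of a walk of least weight. -/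
noncomputable def hopDist (G : SimpleGraph V) (w : Sym2 V → ℝ) (u v : V) : ℕ :=
  sInf {k | ∃ p : G.Walk u v, walkWeight w p = weightedDist G w u v ∧ p.length = k}

/-- Edges may have weight zero, so the distance need not drop along a shortest path; the hop count
does drop, and serves as termination measure from here on. -/
theorem exists_next_hop [Fintype V] (hw : ∀ e ∈ G.edgeSet, 0 ≤ w e) {u v : V}
    (h : G.Reachable u v) (huv : u ≠ v) :
    ∃ x, G.Adj u x ∧ weightedDist G w u v = w s(u, x) + weightedDist G w x v ∧
      hopDist G w x v < hopDist G w u v := by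
  obtain ⟨p₀, hp₀⟩ := exists_walkWeight_eq_weightedDist hw h
  obtain ⟨p, hp, hl⟩ : hopDist G w u v ∈
      {k | ∃ p : G.Walk u v, walkWeight w p = weightedDist G w u v ∧ p.length = k} :=
    Nat.sInf_mem ⟨_, p₀, hp₀, rfl⟩
  cases p with
  | nil => exact absurd rfl huv
  | @cons _ x _ hux p =>
    rw [walkWeight_cons] at hp
    have h1 := weightedDist_le hw p
    have h2 := weightedDist_triangle hw hux.reachable p.reachable
    have h3 := weightedDist_le_of_adj hw hux
    have h4 : walkWeight w p = weightedDist G w x v := by linarith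
    refine ⟨x, hux, by linarith, ?_⟩
    have : hopDist G w x v ≤ p.length := Nat.sInf_le ⟨p, h4, rfl⟩
    simp only [SimpleGraph.Walk.length_cons] at hl
    omega

open Classical in
/-- The next vertex after `u` on a shortest path from `u` to `v`. It is `u` if there is none. -/
noncomputable def nextHop (G : SimpleGraph V) (w : Sym2 V → ℝ) (u v : V) : V :=
  if h : ∃ x, G.Adj u x ∧ weightedDist G w u v = w s(u, x) + weightedDist G w x v ∧
      hopDist G w x v < hopDist G w u v ∧ G.Reachable u v ∧ u ≠ v then h.choose else u

theorem nextHop_spec [Fintype V] (hw : ∀ e ∈ G.edgeSet, 0 ≤ w e) {u v : V}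
    (h : G.Reachable u v) (huv : u ≠ v) :
    G.Adj u (nextHop G w u v) ∧
      weightedDist G w u v = w s(u, nextHop G w u v) + weightedDist G w (nextHop G w u v) v ∧
      hopDist G w (nextHop G w u v) v < hopDist G w u v := by
  obtain ⟨x, h1, h2, h3⟩ := exists_next_hop hw h huv
  have hx : ∃ x, G.Adj u x ∧ weightedDist G w u v = w s(u, x) + weightedDist G w x v ∧
      hopDist G w x v < hopDist G w u v ∧ G.Reachable u v ∧ u ≠ v := ⟨x, h1, h2, h3, h, huv⟩
  rw [nextHop, dif_pos hx]
  exact ⟨hx.choose_spec.1, hx.choose_spec.2.1, hx.choose_spec.2.2.1⟩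

/-- Reachability and `u ≠ v` are part of the condition in `nextHop` so that a nontrivial next hop
gives them back, as a tree edge must. -/
theorem nextHop_eq_self_or (u v : V) :
    nextHop G w u v = u ∨ hopDist G w (nextHop G w u v) v < hopDist G w u v ∧
      G.Reachable u v ∧ u ≠ v := by
  by_cases hx : ∃ x, G.Adj u x ∧ weightedDist G w u v = w s(u, x) + weightedDist G w x v ∧
      hopDist G w x v < hopDist G w u v ∧ G.Reachable u v ∧ u ≠ v
  · right
    rw [nextHop, dif_pos hx]
    exact hx.choose_spec.2.2
  · left
    rw [nextHop, dif_neg hx]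

end Distance

/-! ### Vicinities -/

section Ball

variable {n : ℕ} {G : SimpleGraph (Fin n)} {w : Sym2 (Fin n) → ℝ}

/-- `t` precedes `z` in the order of the vertices by their distance from `x`, ties broken by
name. -/
def Closer (G : SimpleGraph (Fin n)) (w : Sym2 (Fin n) → ℝ) (x t z : Fin n) : Prop :=
  weightedDist G w x t < weightedDist G w x z ∨
    weightedDist G w x t = weightedDist G w x z ∧ t < z

open Classical in
/-- The `q` vertices closest to `x` (all reachable ones, if there are fewer than `q`). -/
noncomputable def vicinity (G : SimpleGraph (Fin n)) (w : Sym2 (Fin n) → ℝ) (q : ℕ) (x : Fin n) :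
    Finset (Fin n) :=
  {z | G.Reachable x z ∧ (Finset.univ.filter fun t => G.Reachable x t ∧ Closer G w x t z).card < q}

theorem mem_vicinity {q : ℕ} {x z : Fin n} [DecidablePred fun t => G.Reachable x t ∧ Closer G w x t z] :
    z ∈ vicinity G w q x ↔ G.Reachable x z ∧
      (Finset.univ.filter fun t => G.Reachable x t ∧ Closer G w x t z).card < q := by
  simp only [vicinity, Finset.mem_filter_univ]
  refine and_congr_right fun _ => ?_
  convert Iff.rfl

theorem Closer.trans {x a b c : Fin n} (h : Closer G w x a b) (h' : Closer G w x b c) :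
    Closer G w x a c := by
  rcases h with h | ⟨h, h1⟩ <;> rcases h' with h' | ⟨h', h2⟩
  · exact Or.inl (h.trans h')
  · exact Or.inl (h.trans_eq h')
  · exact Or.inl (h.trans_lt h')
  · exact Or.inr ⟨h.trans h', h1.trans h2⟩

theorem closer_irrefl (x a : Fin n) : ¬ Closer G w x a a := by
  simp [Closer]

theorem closer_or_closer {x a b : Fin n} (h : a ≠ b) : Closer G w x a b ∨ Closer G w x b a := by
  rcases lt_trichotomy (weightedDist G w x a) (weightedDist G w x b) with h1 | h1 | h1
  · exact Or.inl (Or.inl h1)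
  · rcases lt_or_gt_of_ne h with h2 | h2
    · exact Or.inl (Or.inr ⟨h1, h2⟩)
    · exact Or.inr (Or.inr ⟨h1.symm, h2⟩)
  · exact Or.inr (Or.inl h1)

theorem mem_vicinity_of_closer {q : ℕ} {x a b : Fin n} (hb : b ∈ vicinity G w q x)
    (ha : G.Reachable x a) (h : Closer G w x a b) : a ∈ vicinity G w q x := by
  classical
  rw [mem_vicinity] at hb ⊢
  refine ⟨ha, lt_of_le_of_lt (Finset.card_le_card ?_) hb.2⟩
  intro t ht
  rw [Finset.mem_filter_univ] at ht ⊢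
  exact ⟨ht.1, ht.2.trans h⟩

theorem closer_of_mem_of_notMem {q : ℕ} {x a b : Fin n} (ha : a ∈ vicinity G w q x)
    (hb : b ∉ vicinity G w q x) (hr : G.Reachable x b) : Closer G w x a b := by
  rcases closer_or_closer (x := x) (G := G) (w := w) (a := a) (b := b)
    (by rintro rfl; exact hb ha) with h | h
  · exact h
  · exact absurd (mem_vicinity_of_closer ha hr h) hb

theorem weightedDist_le_of_mem_of_notMem {q : ℕ} {x a b : Fin n} (ha : a ∈ vicinity G w q x)
    (hb : b ∉ vicinity G w q x) (hr : G.Reachable x b) :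
    weightedDist G w x a ≤ weightedDist G w x b := by
  rcases closer_of_mem_of_notMem ha hb hr with h | h
  · exact h.le
  · exact h.1.le

/-- A finite strict total order has at least `min k |s|` elements of rank less than `k`. -/
theorem card_filter_rank_lt {α : Type*} (s : Finset α) (r : α → α → Prop)
    [DecidableRel r] (hirr : ∀ a, ¬ r a a) (htr : ∀ a b c, r a b → r b c → r a c)
    (htot : ∀ a b, a ≠ b → r a b ∨ r b a) (k : ℕ) :
    (s.filter fun z => (s.filter fun t => r t z).card < k).card = min k s.card := by
  classical
  -- The rank is strictly monotone, hence injective, and takes values below `s.card`; so the ranks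
  -- are exactly `0, …, s.card - 1`.
  have hinj : Set.InjOn (fun z => (s.filter fun t => r t z).card) s := by
    have key : ∀ a ∈ s, ∀ b ∈ s, r a b →
        (s.filter fun t => r t a).card < (s.filter fun t => r t b).card := by
      intro a ha b hb hab
      refine Finset.card_lt_card ⟨fun t ht => ?_, fun h => ?_⟩
      · rw [Finset.mem_filter] at ht ⊢
        exact ⟨ht.1, htr _ _ _ ht.2 hab⟩
      · exact hirr a (Finset.mem_filter.1 (h (Finset.mem_filter.2 ⟨ha, hab⟩))).2
    intro a ha b hb hab
    by_contra hne
    rcases htot a b hne with h | h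
    · exact (key a ha b hb h).ne hab
    · exact (key b hb a ha h).ne hab.symm
  have himg : s.image (fun z => (s.filter fun t => r t z).card) = Finset.range s.card := by
    refine Finset.eq_of_subset_of_card_le (fun m hm => ?_) ?_
    · obtain ⟨z, hz, rfl⟩ := Finset.mem_image.1 hm
      refine Finset.mem_range.2 (Finset.card_lt_card ⟨Finset.filter_subset _ _, fun h => ?_⟩)
      exact hirr z (Finset.mem_filter.1 (h hz)).2
    · rw [Finset.card_image_of_injOn hinj, Finset.card_range]
  rw [← Finset.card_image_of_injOn (f := fun z => (s.filter fun t => r t z).card)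
    (hinj.mono (Finset.coe_subset.2 (Finset.filter_subset _ _)))]
  have : (s.filter fun z => (s.filter fun t => r t z).card < k).image
      (fun z => (s.filter fun t => r t z).card) = Finset.range (min k s.card) := by
    ext m
    have := congrArg (m ∈ ·) himg
    simp only [Finset.mem_image, Finset.mem_range, eq_iff_iff] at this
    simp only [Finset.mem_image, Finset.mem_filter, Finset.mem_range, lt_min_iff, ← this]
    constructor
    · rintro ⟨z, ⟨h1, h2⟩, rfl⟩
      exact ⟨h2, z, h1, rfl⟩
    · rintro ⟨h2, z, h1, rfl⟩
      exact ⟨z, ⟨h1, h2⟩, rfl⟩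
  rw [this, Finset.card_range]

theorem card_vicinity [DecidableRel G.Reachable] (q : ℕ) (x : Fin n) :
    (vicinity G w q x).card =
      min q (Finset.univ.filter fun t => G.Reachable x t).card := by
  classical
  rw [← card_filter_rank_lt (Finset.univ.filter fun t => G.Reachable x t) (Closer G w x)
    (closer_irrefl x) (fun _ _ _ => Closer.trans) (fun _ _ => closer_or_closer) q]
  congr 1
  ext z
  simp only [mem_vicinity, Finset.mem_filter, Finset.mem_univ, true_and, Finset.filter_filter]

theorem card_vicinity_le (q : ℕ) (x : Fin n) : (vicinity G w q x).card ≤ q := by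
  classical
  rw [card_vicinity]
  exact min_le_left _ _

/-- The vicinities that must be hit are those that miss a reachable vertex, and these have full
size, as the hitting set argument requires. -/
theorem card_vicinity_of_notMem {q : ℕ} {x z : Fin n} (hr : G.Reachable x z)
    (hz : z ∉ vicinity G w q x) : (vicinity G w q x).card = q := by
  classical
  rw [card_vicinity, min_eq_left]
  by_contra! h
  rw [mem_vicinity] at hz
  refine hz ⟨hr, lt_of_le_of_lt (Finset.card_le_card fun t ht => ?_) h⟩
  rw [Finset.mem_filter_univ] at ht ⊢
  exact ht.1

/-- A vertex `t` that precedes `z` as seen from `y` also precedes it as seen from `x`, by the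
triangle inequality through `y`. In case of equality the same tie-break by name applies; this is why
ties are broken independently of the centre. -/
theorem mem_vicinity_of_dist_add (hw : ∀ e ∈ G.edgeSet, 0 ≤ w e) {q : ℕ} {x y z : Fin n}
    (hz : z ∈ vicinity G w q x) (hxy : G.Reachable x y)
    (h : weightedDist G w x z = weightedDist G w x y + weightedDist G w y z) :
    z ∈ vicinity G w q y := by
  classical
  have hxz := (mem_vicinity.1 hz).1
  have hyz : G.Reachable y z := hxy.symm.trans hxz
  rw [mem_vicinity] at hz ⊢
  refine ⟨hyz, lt_of_le_of_lt (Finset.card_le_card fun t ht => ?_) hz.2⟩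
  rw [Finset.mem_filter_univ] at ht ⊢
  refine ⟨hxy.trans ht.1, ?_⟩
  have h1 := weightedDist_triangle hw hxy ht.1
  rcases ht.2 with h2 | ⟨h2, h3⟩
  · exact Or.inl (by linarith)
  · rcases lt_or_eq_of_le (h1.trans_eq (by rw [h2, ← h])) with h4 | h4
    · exact Or.inl h4
    · exact Or.inr ⟨h4, h3⟩

/-- On the way from `x` to a vertex outside the vicinity of `x`, a shortest path leaves the
vicinity. -/
theorem exists_exit_edge (hw : ∀ e ∈ G.edgeSet, 0 ≤ w e) {q : ℕ} {x v : Fin n}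
    (hx : x ∈ vicinity G w q x) (hv : v ∉ vicinity G w q x) (hr : G.Reachable x v) :
    ∃ y x', y ∈ vicinity G w q x ∧ G.Adj y x' ∧ x' ∉ vicinity G w q x ∧
      weightedDist G w x v = weightedDist G w x y + w s(y, x') + weightedDist G w x' v := by
  -- Follow next hops towards `v`; the invariant is that `y` lies in the vicinity and on a shortest
  -- path from `x` to `v`.
  suffices H : ∀ k, ∀ y ∈ vicinity G w q x, hopDist G w y v = k →
      weightedDist G w x v = weightedDist G w x y + weightedDist G w y v →
      ∃ y x', y ∈ vicinity G w q x ∧ G.Adj y x' ∧ x' ∉ vicinity G w q x ∧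
      weightedDist G w x v = weightedDist G w x y + w s(y, x') + weightedDist G w x' v from
    H _ x hx rfl (by rw [weightedDist_self hw, zero_add])
  intro k
  induction k using Nat.strong_induction_on with
  | _ k ih =>
  intro y hy hk hd
  have hxy : G.Reachable x y := by classical exact (mem_vicinity.1 hy).1
  have hyv : y ≠ v := by rintro rfl; exact hv hy
  obtain ⟨h1, h2, h3⟩ := nextHop_spec hw (hxy.symm.trans hr) hyv
  by_cases hn : nextHop G w y v ∈ vicinity G w q x
  · have h4 := weightedDist_triangle hw hxy h1.reachable
    have h5 := weightedDist_le_of_adj hw h1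
    have h6 := weightedDist_triangle hw (hxy.trans h1.reachable)
      ((hxy.trans h1.reachable).symm.trans hr)
    exact ih _ (hk ▸ h3) _ hn rfl (by linarith)
  · exact ⟨y, _, hy, h1, hn, by linarith⟩

end Ball

/-! ### Hitting sets -/

/-- A family of subsets of a set of size `n`, each of size at least `ℓ`, has a subset of size `t`
that misses at most the fraction `(1 - ℓ / n) ^ t` of them. -/
theorem exists_hitting_set_le {n ℓ : ℕ} (hn : 0 < n) {ι : Type*}
    (s : Finset ι) (B : ι → Finset (Fin n)) (hB : ∀ i ∈ s, ℓ ≤ (B i).card) (t : ℕ) :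
    ∃ H : Finset (Fin n), H.card ≤ t ∧
      ((s.filter fun i => Disjoint (B i) H).card : ℝ) ≤ s.card * (1 - (ℓ : ℝ) / n) ^ t := by
  classical
  have hn' : (0 : ℝ) < n := by exact_mod_cast hn
  induction t with
  | zero => exact ⟨∅, by simp, by simp⟩
  | succ t ih =>
    obtain ⟨H, h1, h2⟩ := ih
    set s' := s.filter fun i => Disjoint (B i) H with hs'
    -- Double counting of the incidences between points and sets not yet hit; by averaging, some
    -- point lies in a fraction `ℓ / n` of these sets.
    have hsum : ∑ x : Fin n, ((s'.filter fun i => x ∈ B i).card : ℝ) = ∑ i ∈ s', ((B i).card : ℝ) := by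
      have := Finset.sum_card_bipartiteAbove_eq_sum_card_bipartiteBelow (s := (Finset.univ : Finset (Fin n)))
        (t := s') (fun x i => x ∈ B i)
      simp only [Finset.bipartiteAbove, Finset.bipartiteBelow, Finset.filter_univ_mem] at this
      exact_mod_cast this
    have hge : ((s'.card : ℝ) * ℓ / n) * n ≤ ∑ x : Fin n, ((s'.filter fun i => x ∈ B i).card : ℝ) := by
      rw [hsum, div_mul_cancel₀ _ hn'.ne', ← nsmul_eq_mul]
      refine Finset.card_nsmul_le_sum _ _ _ fun i hi => ?_
      exact_mod_cast hB i (Finset.mem_of_mem_filter i hi)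
    obtain ⟨x, -, hx⟩ : ∃ x ∈ (Finset.univ : Finset (Fin n)),
        (s'.card : ℝ) * ℓ / n ≤ ((s'.filter fun i => x ∈ B i).card : ℝ) := by
      have : Nonempty (Fin n) := ⟨⟨0, hn⟩⟩
      refine Finset.exists_le_of_sum_le Finset.univ_nonempty ?_
      rw [Finset.sum_const, Finset.card_univ, Fintype.card_fin, nsmul_eq_mul, mul_comm]
      exact hge
    refine ⟨insert x H, (Finset.card_insert_le _ _).trans (by omega), ?_⟩
    have hle : ((s.filter fun i => Disjoint (B i) (insert x H)).card : ℝ) +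
        ((s'.filter fun i => x ∈ B i).card : ℝ) ≤ s'.card := by
      have h3 : s.filter (fun i => Disjoint (B i) (insert x H)) ⊆ s'.filter fun i => ¬ x ∈ B i := by
        intro i hi
        simp only [hs', Finset.mem_filter, Finset.disjoint_insert_right] at hi ⊢
        exact ⟨⟨hi.1, hi.2.2⟩, hi.2.1⟩
      have h4 := Finset.card_le_card h3
      have h5 := Finset.card_filter_add_card_filter_not (s := s') (fun i => x ∈ B i)
      exact_mod_cast (by omega)
    by_cases hs0 : s.card = 0
    · have : s = ∅ := Finset.card_eq_zero.1 hs0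
      simp [this]
    have h0 : (0 : ℝ) ≤ 1 - ℓ / n := by
      obtain ⟨i, hi⟩ := Finset.card_pos.1 (Nat.pos_of_ne_zero hs0)
      have : ℓ ≤ n := (hB i hi).trans (by simpa using (B i).card_le_univ)
      have : (ℓ : ℝ) ≤ n := by exact_mod_cast this
      rw [sub_nonneg, div_le_one hn']
      exact this
    calc ((s.filter fun i => Disjoint (B i) (insert x H)).card : ℝ)
        ≤ s'.card - s'.card * ℓ / n := by linarith
      _ = s'.card * (1 - ℓ / n) := by ring
      _ ≤ s.card * (1 - (ℓ : ℝ) / n) ^ t * (1 - ℓ / n) := mul_le_mul_of_nonneg_right h2 h0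
      _ = _ := by ring

/-- A family of at most `n` subsets of a set of size `n`, each of size at least `ℓ`, has a hitting
set of size at most `n / ℓ * log n + 2`. -/
theorem exists_hitting_set {n ℓ : ℕ} (hn : 0 < n) (hℓ : 0 < ℓ) (s : Finset (Fin n))
    (B : Fin n → Finset (Fin n)) (hB : ∀ i ∈ s, ℓ ≤ (B i).card) :
    ∃ H : Finset (Fin n), (H.card : ℝ) ≤ n / ℓ * Real.log n + 2 ∧
      ∀ i ∈ s, ∃ h ∈ H, h ∈ B i := by
  classical
  have hn' : (0 : ℝ) < n := by exact_mod_cast hn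
  have hℓ' : (0 : ℝ) < ℓ := by exact_mod_cast hℓ
  have hlog : 0 ≤ Real.log n := Real.log_natCast_nonneg n
  rcases s.eq_empty_or_nonempty with rfl | hs
  · exact ⟨∅, by simp; positivity, by simp⟩
  obtain ⟨i₀, hi₀⟩ := hs
  -- With `t` strictly above `(n / ℓ) log n`, fewer than `n * exp (-log n) = 1` sets are missed,
  -- hence none.
  set t : ℕ := ⌊(n : ℝ) / ℓ * Real.log n⌋₊ + 1 with ht
  obtain ⟨H, h1, h2⟩ := exists_hitting_set_le hn s B hB t
  have hle : (H.card : ℝ) ≤ n / ℓ * Real.log n + 2 := by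
    have h3 := Nat.floor_le (a := (n : ℝ) / ℓ * Real.log n) (by positivity)
    have h4 : (H.card : ℝ) ≤ t := by exact_mod_cast h1
    rw [ht] at h4
    push_cast at h4
    linarith
  refine ⟨H, hle, fun i hi => ?_⟩
  by_contra! hno
  have hlt : ((s.filter fun i => Disjoint (B i) H).card : ℝ) < 1 := by
    refine lt_of_le_of_lt h2 ?_
    have h0 : (0 : ℝ) ≤ 1 - ℓ / n := by
      have : ℓ ≤ n := (hB i₀ hi₀).trans (by simpa using (B i₀).card_le_univ)
      have : (ℓ : ℝ) ≤ n := by exact_mod_cast this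
      rw [sub_nonneg, div_le_one hn']
      exact this
    have h3 : (s.card : ℝ) ≤ n := by exact_mod_cast (by simpa using s.card_le_univ)
    have h4 : (n : ℝ) / ℓ * Real.log n < t := by
      rw [ht]; push_cast; exact Nat.lt_floor_add_one _
    have h5 : (1 - (ℓ : ℝ) / n) ^ t ≤ Real.exp (-(ℓ / n) * t) := by
      rw [mul_comm, Real.exp_nat_mul]
      refine pow_le_pow_left₀ h0 ?_ t
      have := Real.add_one_le_exp (-((ℓ : ℝ) / n))
      linarith
    have h6 : Real.exp (-(ℓ / n) * t) < Real.exp (-Real.log n) := by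
      rw [Real.exp_lt_exp]
      have : (ℓ : ℝ) / n * (n / ℓ * Real.log n) < ℓ / n * t :=
        mul_lt_mul_of_pos_left h4 (by positivity)
      have h7 : (ℓ : ℝ) / n * (n / ℓ * Real.log n) = Real.log n := by field_simp
      linarith
    rw [Real.exp_neg, Real.exp_log hn'] at h6
    calc (s.card : ℝ) * (1 - (ℓ : ℝ) / n) ^ t ≤ n * (1 - (ℓ : ℝ) / n) ^ t :=
          mul_le_mul_of_nonneg_right h3 (by positivity)
      _ < n * (n : ℝ)⁻¹ := mul_lt_mul_of_pos_left (h5.trans_lt h6) hn'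
      _ = 1 := mul_inv_cancel₀ hn'.ne'
  have hpos : 0 < (s.filter fun i => Disjoint (B i) H).card :=
    Finset.card_pos.2 ⟨i, Finset.mem_filter.2 ⟨hi, Finset.disjoint_right.2 fun h hh => hno h hh⟩⟩
  have : (1 : ℝ) ≤ (s.filter fun i => Disjoint (B i) H).card := by exact_mod_cast hpos
  linarith

/-! ### Rooted forests, preorder intervals and heavy children -/

/-- A rooted forest: every vertex has a parent of smaller rank, or is a root and its own parent. -/
structure RootedForest (V : Type*) where
  parent : V → V
  rank : V → ℕ
  parent_eq_or (y : V) : parent y = y ∨ rank (parent y) < rank y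

/-- The lists with a given prefix are convex in the lexicographic order. Since preorder is the
lexicographic order of root paths, this makes every subtree an interval. -/
theorem List.prefix_of_le_of_le {α : Type*} [LinearOrder α] {p a b c : List α}
    (ha : p <+: a) (hc : p <+: c) (hab : a ≤ b) (hbc : b ≤ c) : p <+: b := by
  induction p generalizing a b c with
  | nil => exact List.nil_prefix
  | cons x p ih =>
    obtain ⟨a, rfl⟩ := ha
    obtain ⟨c, rfl⟩ := hc
    cases b with
    | nil => exact absurd (List.nil_lt_cons x (p ++ a)) (not_lt.2 hab)
    | cons y b =>
      rw [List.cons_append, ← not_lt, List.cons_lt_cons_iff, not_or] at hab hbc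
      have hxy : x = y := le_antisymm (not_lt.1 hab.1) (not_lt.1 hbc.1)
      subst hxy
      simp only [lt_self_iff_false, true_and, not_false_eq_true, not_lt] at hab hbc
      rw [List.cons_prefix_cons]
      exact ⟨rfl, ih ⟨a, rfl⟩ ⟨c, rfl⟩ hab hbc⟩

namespace RootedForest

variable {V : Type*} (F : RootedForest V)

open Classical in
/-- The last `k + 1` vertices of the path from the root to `y`. -/
noncomputable def rootPathAux : ℕ → V → List V
  | 0, y => [y]
  | k + 1, y => if F.parent y = y then [y] else rootPathAux k (F.parent y) ++ [y]

/-- The path from the root to `y`. -/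
noncomputable def rootPath (y : V) : List V := F.rootPathAux (F.rank y) y

/-- The first argument is only fuel: any amount that is at least the rank reaches the root. -/
theorem rootPathAux_congr {k k' : ℕ} {y : V} (h : F.rank y ≤ k) (h' : F.rank y ≤ k') :
    F.rootPathAux k y = F.rootPathAux k' y := by
  induction k generalizing y k' with
  | zero =>
    have hp : F.parent y = y := (F.parent_eq_or y).resolve_right (by omega)
    cases k' <;> simp [rootPathAux, hp]
  | succ k ih =>
    rcases F.parent_eq_or y with hp | hp
    · cases k' <;> simp [rootPathAux, hp]
    · cases k' with
      | zero => omega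
      | succ k' =>
        simp only [rootPathAux]
        rw [ih (k' := k') (by omega) (by omega)]

theorem rootPath_of_parent_eq {y : V} (h : F.parent y = y) : F.rootPath y = [y] := by
  rw [rootPath]
  cases F.rank y <;> simp [rootPathAux, h]

theorem rootPath_of_parent_ne {y : V} (h : F.parent y ≠ y) :
    F.rootPath y = F.rootPath (F.parent y) ++ [y] := by
  have hr := (F.parent_eq_or y).resolve_left h
  rw [rootPath, F.rootPathAux_congr le_rfl (Nat.le_succ _), rootPathAux, if_neg h,
    F.rootPathAux_congr (k' := F.rank (F.parent y)) hr.le le_rfl, rootPath]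

theorem getLast?_rootPath (y : V) : (F.rootPath y).getLast? = some y := by
  by_cases h : F.parent y = y
  · simp [F.rootPath_of_parent_eq h]
  · simp [F.rootPath_of_parent_ne h]

theorem rootPath_injective : Function.Injective F.rootPath := fun a b h =>
  Option.some_injective _ (by rw [← F.getLast?_rootPath a, h, F.getLast?_rootPath])

/-- `c` is a child of `y`. -/
def IsChild (y c : V) : Prop := F.parent c = y ∧ c ≠ y

theorem IsChild.rootPath_eq {F : RootedForest V} {y c : V} (h : F.IsChild y c) :
    F.rootPath c = F.rootPath y ++ [c] := by
  obtain ⟨rfl, h⟩ := h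
  exact F.rootPath_of_parent_ne h.symm

variable [Fintype V]

open Classical in
/-- The descendants of `y`, including `y` itself. -/
noncomputable def descendants (y : V) : Finset V := {z | F.rootPath y <+: F.rootPath z}

theorem mem_descendants {y z : V} : z ∈ F.descendants y ↔ F.rootPath y <+: F.rootPath z := by
  simp [descendants]

theorem self_mem_descendants (y : V) : y ∈ F.descendants y := by
  simp [mem_descendants]

theorem IsChild.descendants_ssubset {F : RootedForest V} {y c : V} (h : F.IsChild y c) :
    F.descendants c ⊂ F.descendants y := by
  refine ⟨fun z hz => ?_, fun hs => ?_⟩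
  · rw [mem_descendants] at hz ⊢
    exact (h.rootPath_eq ▸ List.prefix_append _ _ : F.rootPath y <+: F.rootPath c).trans hz
  · have := (F.mem_descendants.1 (hs (F.self_mem_descendants y))).length_le
    rw [h.rootPath_eq] at this
    simp at this

/-- The root paths of two siblings have equal length, and two prefixes of equal length of one list
coincide. -/
theorem IsChild.eq_of_mem {F : RootedForest V} {y c c' z : V} (h : F.IsChild y c)
    (h' : F.IsChild y c') (hz : z ∈ F.descendants c) (hz' : z ∈ F.descendants c') : c = c' := by
  rw [mem_descendants] at hz hz'
  refine F.rootPath_injective ((List.prefix_of_prefix_length_le hz hz' ?_).eq_of_length ?_) <;>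
  simp [h.rootPath_eq, h'.rootPath_eq]

theorem IsChild.self_notMem {F : RootedForest V} {y c : V} (h : F.IsChild y c) :
    y ∉ F.descendants c := fun hy => by
  have := (F.mem_descendants.1 hy).length_le
  rw [h.rootPath_eq] at this
  simp at this

/-- Climb from `v` through its parents until the next parent is `y`; the rank decreases. -/
theorem exists_child {y v : V} (h : v ∈ F.descendants y) (hne : v ≠ y) :
    ∃ c, F.IsChild y c ∧ v ∈ F.descendants c := by
  induction hk : F.rank v using Nat.strong_induction_on generalizing v with
  | _ k ih =>
  rw [mem_descendants] at h
  by_cases hp : F.parent v = v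
  · rw [F.rootPath_of_parent_eq hp] at h
    rcases List.prefix_cons_iff.1 h with h1 | ⟨t, h1, h2⟩
    · have := F.getLast?_rootPath y
      simp [h1] at this
    · rw [List.prefix_nil.1 h2] at h1
      have := F.getLast?_rootPath y
      simp [h1] at this
      exact absurd this hne
  · have h0 := F.rootPath_of_parent_ne hp
    rw [h0, List.prefix_concat_iff] at h
    rcases h with h | h
    · exact absurd (F.rootPath_injective (h0.trans h.symm)) hne
    · by_cases hy : F.parent v = y
      · exact ⟨v, ⟨hy, hne⟩, F.self_mem_descendants v⟩
      · obtain ⟨c, hc, hvc⟩ := ih _ (hk ▸ (F.parent_eq_or v).resolve_left hp)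
          (F.mem_descendants.2 h) hy rfl
        refine ⟨c, hc, F.mem_descendants.2 ((F.mem_descendants.1 hvc).trans ?_)⟩
        rw [h0]
        exact List.prefix_append _ _

open Classical in
/-- The children of `y` with more than the fraction `1 / b` of the descendants of `y`. -/
noncomputable def heavyChildren (b : ℕ) (y : V) : Finset V :=
  {c | F.IsChild y c ∧ (F.descendants y).card < b * (F.descendants c).card}

theorem mem_heavyChildren {b : ℕ} {y c : V} : c ∈ F.heavyChildren b y ↔
    F.IsChild y c ∧ (F.descendants y).card < b * (F.descendants c).card := by
  simp [heavyChildren]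

/-- The subtrees of the heavy children are disjoint, and each takes more than a fraction `1 / b` of
the descendants of `y`. -/
theorem card_heavyChildren_le (b : ℕ) (y : V) : (F.heavyChildren b y).card ≤ b := by
  classical
  have hdis : ∀ c ∈ F.heavyChildren b y, ∀ c' ∈ F.heavyChildren b y, c ≠ c' →
      Disjoint (F.descendants c) (F.descendants c') := by
    intro c hc c' hc' hne
    refine Finset.disjoint_left.2 fun z hz hz' => hne ?_
    exact (F.mem_heavyChildren.1 hc).1.eq_of_mem (F.mem_heavyChildren.1 hc').1 hz hz'
  have h1 : ∑ c ∈ F.heavyChildren b y, (F.descendants c).card ≤ (F.descendants y).card := by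
    rw [← Finset.card_biUnion hdis]
    refine Finset.card_le_card (Finset.biUnion_subset.2 fun c hc => ?_)
    exact (F.mem_heavyChildren.1 hc).1.descendants_ssubset.1
  have h2 : (F.heavyChildren b y).card * (F.descendants y).card ≤
      b * ∑ c ∈ F.heavyChildren b y, (F.descendants c).card := by
    rw [Finset.mul_sum, ← smul_eq_mul]
    exact Finset.card_nsmul_le_sum _ _ _ fun c hc => (F.mem_heavyChildren.1 hc).2.le
  have h3 : 0 < (F.descendants y).card := Finset.card_pos.2 ⟨y, F.self_mem_descendants y⟩
  exact Nat.le_of_mul_le_mul_right (h2.trans (Nat.mul_le_mul_left b h1)) h3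

variable [LinearOrder V]

/-- The number of `z` in preorder. -/
noncomputable def preorderNum (z : V) : ℕ :=
  (Finset.univ.filter fun t => F.rootPath t < F.rootPath z).card

theorem preorderNum_lt_card (z : V) : F.preorderNum z < Fintype.card V :=
  Finset.card_lt_card ⟨Finset.filter_subset _ _, fun h => by simpa using h (Finset.mem_univ z)⟩

theorem preorderNum_lt_of_lt {a b : V} (h : F.rootPath a < F.rootPath b) :
    F.preorderNum a < F.preorderNum b := by
  refine Finset.card_lt_card ⟨fun t ht => ?_, fun hs => ?_⟩
  · rw [Finset.mem_filter_univ] at ht ⊢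
    exact ht.trans h
  · have := hs ((Finset.mem_filter_univ (p := fun t => F.rootPath t < F.rootPath b) a).2 h)
    simp at this

theorem rootPath_le_of_preorderNum_le {a b : V} (h : F.preorderNum a ≤ F.preorderNum b) :
    F.rootPath a ≤ F.rootPath b :=
  not_lt.1 fun h' => (F.preorderNum_lt_of_lt h').not_ge h

theorem preorderNum_injective : Function.Injective F.preorderNum := fun _ _ h =>
  F.rootPath_injective (le_antisymm (F.rootPath_le_of_preorderNum_le h.le)
    (F.rootPath_le_of_preorderNum_le h.ge))

/-- The least preorder number of a descendant. -/
noncomputable def firstNum (y : V) : ℕ :=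
  (F.descendants y).inf' ⟨y, F.self_mem_descendants y⟩ F.preorderNum

/-- The largest preorder number of a descendant. -/
noncomputable def lastNum (y : V) : ℕ :=
  (F.descendants y).sup' ⟨y, F.self_mem_descendants y⟩ F.preorderNum

theorem mem_descendants_iff_preorderNum {y z : V} : z ∈ F.descendants y ↔
    F.firstNum y ≤ F.preorderNum z ∧ F.preorderNum z ≤ F.lastNum y := by
  refine ⟨fun h => ⟨Finset.inf'_le _ h, Finset.le_sup' _ h⟩, fun ⟨h1, h2⟩ => ?_⟩
  obtain ⟨a, ha, ha'⟩ := Finset.exists_mem_eq_inf' ⟨y, F.self_mem_descendants y⟩ F.preorderNum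
  obtain ⟨c, hc, hc'⟩ := Finset.exists_mem_eq_sup' ⟨y, F.self_mem_descendants y⟩ F.preorderNum
  rw [firstNum, ha'] at h1
  rw [lastNum, hc'] at h2
  rw [mem_descendants] at ha hc ⊢
  exact List.prefix_of_le_of_le ha hc (F.rootPath_le_of_preorderNum_le h1)
    (F.rootPath_le_of_preorderNum_le h2)

theorem firstNum_lt_card (y : V) : F.firstNum y < Fintype.card V :=
  lt_of_le_of_lt (Finset.inf'_le _ (F.self_mem_descendants y)) (F.preorderNum_lt_card y)

theorem lastNum_lt_card (y : V) : F.lastNum y < Fintype.card V := by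
  exact (Finset.sup'_lt_iff (H := ⟨y, F.self_mem_descendants y⟩)).2
    fun z _ => F.preorderNum_lt_card z

end RootedForest

/-! ### Forwarding along prescribed actions -/

/-- Used once, to put the empty header in place of the initial header that the source reads from its
table. -/
theorem Delivers.of_header_eq {n : ℕ} {G : SimpleGraph (Fin n)} {A : ForwardingAlgorithm}
    {P : PortNumbering G} {T : Fin n → List Bool} {b : ℝ} {u v : Fin n} {h h' : List Bool}
    {p : G.Walk u v} (hp : Delivers A P T b v h p) (hA : A (T u, v, h') = A (T u, v, h)) :
    Delivers A P T b v h' p := by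
  cases hp with
  | deliver _ h1 => exact .deliver _ (hA.trans h1)
  | forward hux p _ k h1 hb hp => exact .forward hux p _ k (hA.trans h1) hb hp

section Routing

variable {n : ℕ} {G : SimpleGraph (Fin n)}

open Classical in
/-- The port of `u` towards its neighbour `x`. -/
noncomputable def portTo (P : PortNumbering G) (u x : Fin n) : ℕ :=
  if h : G.Adj u x then (P u ⟨x, h⟩ : ℕ) else 0

theorem portTo_le (P : PortNumbering G) (u x : Fin n) : portTo P u x ≤ n := by
  rw [portTo]
  split_ifs with h
  · refine (P u ⟨x, h⟩).2.le.trans ?_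
    simpa only [Nat.card_fin] using Finite.card_subtype_le (fun y => y ∈ G.neighborSet u)
  · exact Nat.zero_le _

/-- The tables `T` contain the actions prescribed by `core`: at the vertex `y`, for the class `c`
and the number `m`, the action `p`. -/
def Realizes (core : Fin n → ℕ → ℕ → ℕ → Prop) (T : Fin n → List Bool) : Prop :=
  ∀ y c m p, core y c m p → ∃ r, lookupRow (T y) c m = some r ∧ fieldValue r 3 = p

/-- With all tables that contain the prescribed actions, a message for `v` that is at `x` with
header `ρ` is delivered along a walk of weight at most `W`, and the header never becomes longer. -/
def Routes (w : Sym2 (Fin n) → ℝ) (P : PortNumbering G) (core : Fin n → ℕ → ℕ → ℕ → Prop)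
    (v x : Fin n) (ρ : List (ℕ × ℕ × ℕ)) (W : ℝ) : Prop :=
  ∀ T, Realizes core T → ∀ B : ℝ, ((encodeRoute ρ).length : ℝ) ≤ B →
    ∃ p : G.Walk x v, Delivers tableForwarding P T B v (encodeRoute ρ) p ∧ walkWeight w p ≤ W

variable {w : Sym2 (Fin n) → ℝ} {P : PortNumbering G} {core : Fin n → ℕ → ℕ → ℕ → Prop}
  {v x y : Fin n} {c m k : ℕ} {ρ : List (ℕ × ℕ × ℕ)} {W : ℝ}

theorem Routes.mono {W' : ℝ} (h : Routes w P core v x ρ W) (hW : W ≤ W') :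
    Routes w P core v x ρ W' := fun T hT B hB =>
  let ⟨p, h1, h2⟩ := h T hT B hB
  ⟨p, h1, h2.trans hW⟩

theorem Routes.deliver (h : core v c m 0) : Routes w P core v v ((c, m, 0) :: ρ) 0 := by
  intro T hT B _
  obtain ⟨r, h1, h2⟩ := hT _ _ _ _ h
  refine ⟨.nil, .deliver _ ?_, by simp [walkWeight]⟩
  rw [tableForwarding_of_ne_nil _ _ (encodeRoute_cons_ne_nil _ _), routeStep_encodeRoute_cons h1]
  simp [h2]

theorem Routes.pop (h : core x c m 0) (hxy : G.Adj x y) (hy : Routes w P core v y ρ W) :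
    Routes w P core v x ((c, m, portTo P x y + 1) :: ρ) (w s(x, y) + W) := by
  intro T hT B hB
  obtain ⟨r, h1, h2⟩ := hT _ _ _ _ h
  have hB' : ((encodeRoute ρ).length : ℝ) ≤ B :=
    le_trans (by exact_mod_cast length_encodeRoute_le_cons _ _) hB
  obtain ⟨p, h3, h4⟩ := hy T hT B hB'
  refine ⟨.cons hxy p, .forward hxy p _ _ ?_ hB' h3, by rw [walkWeight_cons]; linarith⟩
  rw [tableForwarding_of_ne_nil _ _ (encodeRoute_cons_ne_nil _ _), routeStep_encodeRoute_cons h1]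
  simp [h2, portTo, hxy]

theorem Routes.forward (h : core x c m (portTo P x y + 1)) (hxy : G.Adj x y)
    (hy : Routes w P core v y ((c, m, k) :: ρ) W) :
    Routes w P core v x ((c, m, k) :: ρ) (w s(x, y) + W) := by
  intro T hT B hB
  obtain ⟨r, h1, h2⟩ := hT _ _ _ _ h
  obtain ⟨p, h3, h4⟩ := hy T hT B hB
  refine ⟨.cons hxy p, .forward hxy p _ _ ?_ hB h3, by rw [walkWeight_cons]; linarith⟩
  rw [tableForwarding_of_ne_nil _ _ (encodeRoute_cons_ne_nil _ _), routeStep_encodeRoute_cons h1]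
  simp [h2, portTo, hxy]

/-! ### Shortest path trees and the rows of a table -/

/-- The tree of shortest paths to `h`. -/
noncomputable def shortestPathTree (G : SimpleGraph (Fin n)) (w : Sym2 (Fin n) → ℝ) (h : Fin n) :
    RootedForest (Fin n) where
  parent y := nextHop G w y h
  rank y := hopDist G w y h
  parent_eq_or y := (nextHop_eq_self_or y h).imp_right And.left

/-- The tree is defined by next hops towards `h` but used away from `h`; the graph being undirected,
the edges can be reversed. -/
theorem isChild_shortestPathTree (hw : ∀ e ∈ G.edgeSet, 0 ≤ w e) {h y c : Fin n}
    (hc : (shortestPathTree G w h).IsChild y c) :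
    G.Adj y c ∧ weightedDist G w c h = w s(y, c) + weightedDist G w y h := by
  obtain ⟨h1, h2⟩ := hc
  change nextHop G w c h = y at h1
  rcases nextHop_eq_self_or (G := G) (w := w) c h with h3 | ⟨-, h3, h4⟩
  · exact absurd (h3.symm.trans h1) h2
  · obtain ⟨h5, h6, -⟩ := nextHop_spec hw h3 h4
    rw [h1] at h5 h6
    exact ⟨h5.symm, by rw [Sym2.eq_swap]; exact h6⟩

theorem mem_descendants_root (hw : ∀ e ∈ G.edgeSet, 0 ≤ w e) {h v : Fin n}
    (hr : G.Reachable v h) : v ∈ (shortestPathTree G w h).descendants h := by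
  induction hk : hopDist G w v h using Nat.strong_induction_on generalizing v with
  | _ k ih =>
  by_cases hv : v = h
  · rw [hv]
    exact RootedForest.self_mem_descendants _ _
  · obtain ⟨h1, -, h2⟩ := nextHop_spec hw hr hv
    have h3 := ih _ (hk ▸ h2) (h1.symm.reachable.trans hr) rfl
    have h4 : (shortestPathTree G w h).IsChild (nextHop G w v h) v := ⟨rfl, h1.ne⟩
    rw [RootedForest.mem_descendants] at h3 ⊢
    rw [h4.rootPath_eq]
    exact h3.trans (List.prefix_append _ _)

/-- The routing information at `y`: how to reach the vertices of the vicinity of `y`, and how to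
descend in the trees of the shortest paths to the vertices of `H`. -/
noncomputable def coreRows (w : Sym2 (Fin n) → ℝ) (P : PortNumbering G) (q : ℕ)
    (H : Finset (Fin n)) (b : ℕ) (y : Fin n) : Finset (ℕ × ℕ × ℕ × ℕ × List Bool) :=
  insert (1, (y : ℕ), (y : ℕ), 0, [])
    (((vicinity G w q y).erase y).image (fun z : Fin n =>
        (1, (z : ℕ), (z : ℕ), portTo P y (nextHop G w y z) + 1, [])) ∪
      (H.image (fun h : Fin n => ((h : ℕ) + 2, (shortestPathTree G w h).preorderNum y,
        (shortestPathTree G w h).preorderNum y, 0, [])) ∪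
      H.biUnion fun h => ((shortestPathTree G w h).heavyChildren b y).image fun c =>
        ((h : ℕ) + 2, (shortestPathTree G w h).firstNum c, (shortestPathTree G w h).lastNum c,
          portTo P y c + 1, [])))

theorem mem_coreRows {q : ℕ} {H : Finset (Fin n)} {b : ℕ} {y : Fin n}
    {r : ℕ × ℕ × ℕ × ℕ × List Bool} : r ∈ coreRows w P q H b y ↔
      r = (1, (y : ℕ), (y : ℕ), 0, []) ∨
      (∃ z ∈ vicinity G w q y, z ≠ y ∧
        r = (1, (z : ℕ), (z : ℕ), portTo P y (nextHop G w y z) + 1, [])) ∨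
      (∃ h ∈ H, r = ((h : ℕ) + 2, (shortestPathTree G w h).preorderNum y,
        (shortestPathTree G w h).preorderNum y, 0, [])) ∨
      ∃ h ∈ H, ∃ c ∈ (shortestPathTree G w h).heavyChildren b y,
        r = ((h : ℕ) + 2, (shortestPathTree G w h).firstNum c,
          (shortestPathTree G w h).lastNum c, portTo P y c + 1, []) := by
  simp only [coreRows, Finset.mem_insert, Finset.mem_union, Finset.mem_image, Finset.mem_erase,
    Finset.mem_biUnion, eq_comm (a := r)]
  refine or_congr_right (or_congr_left ⟨?_, ?_⟩)
  · rintro ⟨z, ⟨h1, h2⟩, h3⟩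
    exact ⟨z, h2, h1, h3⟩
  · rintro ⟨z, h1, h2, h3⟩
    exact ⟨z, ⟨h2, h1⟩, h3⟩

theorem card_coreRows_le (q : ℕ) (H : Finset (Fin n)) (b : ℕ) (y : Fin n) :
    (coreRows w P q H b y).card ≤ q + 1 + H.card * (b + 1) := by
  refine (Finset.card_insert_le _ _).trans ?_
  refine (Nat.add_le_add_right (Finset.card_union_le _ _) 1).trans ?_
  have h1 : (((vicinity G w q y).erase y).image (fun z : Fin n =>
      ((1, (z : ℕ), (z : ℕ), portTo P y (nextHop G w y z) + 1, []) :
        ℕ × ℕ × ℕ × ℕ × List Bool))).card ≤ q :=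
    Finset.card_image_le.trans ((Finset.card_erase_le).trans (card_vicinity_le q y))
  have h2 : (H.image (fun h : Fin n => (((h : ℕ) + 2, (shortestPathTree G w h).preorderNum y,
      (shortestPathTree G w h).preorderNum y, 0, []) : ℕ × ℕ × ℕ × ℕ × List Bool))).card ≤ H.card :=
    Finset.card_image_le
  have h3 : (H.biUnion fun h => ((shortestPathTree G w h).heavyChildren b y).image fun c =>
      (((h : ℕ) + 2, (shortestPathTree G w h).firstNum c, (shortestPathTree G w h).lastNum c,
        portTo P y c + 1, []) : ℕ × ℕ × ℕ × ℕ × List Bool)).card ≤ H.card * b :=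
    Finset.card_biUnion_le_card_mul _ _ _ fun h _ =>
      Finset.card_image_le.trans (RootedForest.card_heavyChildren_le _ _ _)
  have h4 := (Finset.card_union_le _ _).trans (Nat.add_le_add h2 h3)
  have h5 := Nat.add_le_add h1 h4
  rw [Nat.mul_add, Nat.mul_one]
  omega

/-- Bounds for the numbers in a row. -/
theorem coreRows_le {q : ℕ} {H : Finset (Fin n)} {b : ℕ} {y : Fin n}
    {r : ℕ × ℕ × ℕ × ℕ × List Bool} (hr : r ∈ coreRows w P q H b y) :
    1 ≤ r.1 ∧ r.1 ≤ n + 1 ∧ r.2.1 ≤ n + 1 ∧ r.2.2.1 ≤ n + 1 ∧ r.2.2.2.1 ≤ n + 1 ∧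
      r.2.2.2.2 = [] := by
  have hy := y.2
  have hp := portTo_le P y
  rcases mem_coreRows.1 hr with rfl | ⟨z, -, -, rfl⟩ | ⟨h, -, rfl⟩ | ⟨h, -, c, -, rfl⟩
  · simp; omega
  · have := z.2
    have := hp (nextHop G w y z)
    simp; omega
  · have := h.2
    have := (shortestPathTree G w h).preorderNum_lt_card y
    rw [Fintype.card_fin] at this
    simp; omega
  · have := h.2
    have h1 := (shortestPathTree G w h).firstNum_lt_card c
    have h2 := (shortestPathTree G w h).lastNum_lt_card c
    rw [Fintype.card_fin] at h1 h2
    have := hp c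
    simp; omega

/-- The actions that the rows of `coreRows` prescribe: at `y`, for the class `c` and the number `m`,
the action `p`. -/
def CoreRule (w : Sym2 (Fin n) → ℝ) (P : PortNumbering G) (q : ℕ) (H : Finset (Fin n)) (b : ℕ)
    (y : Fin n) (c m p : ℕ) : Prop :=
  (c = 1 ∧ m = y ∧ p = 0) ∨
  (∃ z ∈ vicinity G w q y, z ≠ y ∧ c = 1 ∧ m = z ∧ p = portTo P y (nextHop G w y z) + 1) ∨
  (∃ h ∈ H, c = (h : ℕ) + 2 ∧ m = (shortestPathTree G w h).preorderNum y ∧ p = 0) ∨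
  ∃ h ∈ H, ∃ d ∈ (shortestPathTree G w h).heavyChildren b y,
    ∃ z ∈ (shortestPathTree G w h).descendants d, c = (h : ℕ) + 2 ∧
      m = (shortestPathTree G w h).preorderNum z ∧ p = portTo P y d + 1

theorem CoreRule.exists_row {q : ℕ} {H : Finset (Fin n)} {b : ℕ} {y : Fin n} {c m p : ℕ}
    (h : CoreRule w P q H b y c m p) : ∃ r ∈ coreRows w P q H b y, RowMatches r c m := by
  rcases h with ⟨rfl, rfl, rfl⟩ | ⟨z, hz, hzy, rfl, rfl, rfl⟩ | ⟨h, hh, rfl, rfl, rfl⟩ |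
    ⟨h, hh, d, hd, z, hz, rfl, rfl, rfl⟩
  · exact ⟨_, mem_coreRows.2 (.inl rfl), rfl, le_rfl, le_rfl⟩
  · exact ⟨_, mem_coreRows.2 (.inr (.inl ⟨z, hz, hzy, rfl⟩)), rfl, le_rfl, le_rfl⟩
  · exact ⟨_, mem_coreRows.2 (.inr (.inr (.inl ⟨h, hh, rfl⟩))), rfl, le_rfl, le_rfl⟩
  · obtain ⟨h1, h2⟩ := (RootedForest.mem_descendants_iff_preorderNum _).1 hz
    exact ⟨_, mem_coreRows.2 (.inr (.inr (.inr ⟨h, hh, d, hd, rfl⟩))), rfl, h1, h2⟩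

/-- Rows never conflict: the classes separate the vicinity from the trees, and within a tree the
subtrees of distinct children of `y` are disjoint and none contains `y`. -/
theorem CoreRule.action_eq {q : ℕ} {H : Finset (Fin n)} {b : ℕ} {y : Fin n} {c m p : ℕ}
    (h : CoreRule w P q H b y c m p) {r : ℕ × ℕ × ℕ × ℕ × List Bool}
    (hr : r ∈ coreRows w P q H b y) (hm : RowMatches r c m) : r.2.2.2.1 = p := by
  obtain ⟨h1, h2, h3⟩ := hm
  rcases mem_coreRows.1 hr with rfl | ⟨z', -, hz', rfl⟩ | ⟨h', -, rfl⟩ | ⟨h', -, d', hd', rfl⟩ <;>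
  rcases h with ⟨rfl, rfl, rfl⟩ | ⟨z, -, hzy, rfl, rfl, rfl⟩ | ⟨h, -, rfl, rfl, rfl⟩ |
    ⟨h, -, d, hd, z, hz, rfl, rfl, rfl⟩ <;> dsimp only at h1 h2 h3 ⊢ <;> try omega
  -- Four combinations survive: two vicinity rows, the own number of `y` against a child interval in
  -- either order, and two child intervals.
  · rw [Fin.ext (le_antisymm h2 h3)]
  · obtain rfl : h' = h := Fin.ext (by omega)
    rw [← RootedForest.preorderNum_injective _ (le_antisymm h2 h3)] at hz
    exact absurd hz (RootedForest.mem_heavyChildren _ |>.1 hd).1.self_notMem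
  · obtain rfl : h' = h := Fin.ext (by omega)
    exact absurd ((RootedForest.mem_descendants_iff_preorderNum _).2 ⟨h2, h3⟩)
      (RootedForest.mem_heavyChildren _ |>.1 hd').1.self_notMem
  · obtain rfl : h' = h := Fin.ext (by omega)
    have hz' := (RootedForest.mem_descendants_iff_preorderNum _).2 ⟨h2, h3⟩
    rw [(RootedForest.mem_heavyChildren _ |>.1 hd').1.eq_of_mem
      (RootedForest.mem_heavyChildren _ |>.1 hd).1 hz' hz]

/-! ### Existence of short routes -/

/-- By `mem_vicinity_of_dist_add`, each vertex on the way again has `z` in its vicinity and so knows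
the next hop. The remaining route `ρ` after `z` is arbitrary, so that journeys can be chained. -/
theorem routes_vicinity (hw : ∀ e ∈ G.edgeSet, 0 ≤ w e) {q : ℕ} {H : Finset (Fin n)} {b : ℕ}
    {v z : Fin n} {k : ℕ} {ρ : List (ℕ × ℕ × ℕ)} {W : ℝ}
    (hz : Routes w P (CoreRule w P q H b) v z ((1, (z : ℕ), k) :: ρ) W) {x : Fin n}
    (hx : z ∈ vicinity G w q x) :
    Routes w P (CoreRule w P q H b) v x ((1, (z : ℕ), k) :: ρ) (weightedDist G w x z + W) := by
  induction hk : hopDist G w x z using Nat.strong_induction_on generalizing x with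
  | _ j ih =>
  by_cases hxz : z = x
  · subst hxz
    exact hz.mono (by rw [weightedDist_self hw, zero_add])
  · have hr : G.Reachable x z := by classical exact (mem_vicinity.1 hx).1
    obtain ⟨h1, h2, h3⟩ := nextHop_spec hw hr (Ne.symm hxz)
    have h4 : weightedDist G w x z = weightedDist G w x (nextHop G w x z) +
        weightedDist G w (nextHop G w x z) z := by
      have h5 := weightedDist_triangle hw h1.reachable (h1.symm.reachable.trans hr)
      have h6 := weightedDist_le_of_adj hw h1
      linarith
    have h5 := ih _ (hk ▸ h3) (mem_vicinity_of_dist_add hw hx h1.reachable h4) rfl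
    exact (Routes.forward (.inr (.inl ⟨z, hx, hxz, rfl, rfl, rfl⟩)) h1 h5).mono (by linarith)

/-- All three numbers of the header entry `e` are at most `N`. -/
def EntryLE (N : ℕ) (e : ℕ × ℕ × ℕ) : Prop := e.1 ≤ N ∧ e.2.1 ≤ N ∧ e.2.2 ≤ N

/-- The route is built from `v` upwards. A heavy edge leaves the header unchanged, a light edge adds
an entry and is paid for by a factor `b` in the subtree size. The first target `z` is kept among the
descendants of `y`, so that the interval stored one level higher contains its number. -/
theorem exists_routes_tree (hw : ∀ e ∈ G.edgeSet, 0 ≤ w e) {q : ℕ} {H : Finset (Fin n)} {b : ℕ}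
    {h : Fin n} (hh : h ∈ H) {v y : Fin n} (hv : v ∈ (shortestPathTree G w h).descendants y) :
    ∃ z ∈ (shortestPathTree G w h).descendants y, ∃ k ρ,
      Routes w P (CoreRule w P q H b) v y
        (((h : ℕ) + 2, (shortestPathTree G w h).preorderNum z, k) :: ρ)
        (weightedDist G w v h - weightedDist G w y h) ∧
      b ^ ρ.length * ((shortestPathTree G w h).descendants v).card ≤
        ((shortestPathTree G w h).descendants y).card ∧
      ∀ e ∈ ((h : ℕ) + 2, (shortestPathTree G w h).preorderNum z, k) :: ρ, EntryLE (n + 1) e := by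
  induction hk : ((shortestPathTree G w h).descendants y).card using Nat.strong_induction_on
    generalizing y with
  | _ j ih =>
  have hnum (z : Fin n) : (shortestPathTree G w h).preorderNum z ≤ n + 1 := by
    have := (shortestPathTree G w h).preorderNum_lt_card z
    rw [Fintype.card_fin] at this
    omega
  have hh' := h.2
  by_cases hvy : v = y
  · subst hvy
    refine ⟨v, RootedForest.self_mem_descendants _ _, 0, [], ?_, by simp [hk], ?_⟩
    · rw [sub_self]
      exact Routes.deliver (.inr (.inr (.inl ⟨h, hh, rfl, rfl, rfl⟩)))
    · simpa [EntryLE] using hnum v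
  · obtain ⟨c, hc, hvc⟩ := RootedForest.exists_child _ hv hvy
    obtain ⟨hyc, hd⟩ := isChild_shortestPathTree hw hc
    have hlt := Finset.card_lt_card hc.descendants_ssubset
    obtain ⟨z, hz, k, ρ, h1, h2, h3⟩ := ih _ (hk ▸ hlt) hvc rfl
    by_cases hb : c ∈ (shortestPathTree G w h).heavyChildren b y
    · refine ⟨z, hc.descendants_ssubset.1 hz, k, ρ, ?_, by omega, h3⟩
      exact (Routes.forward (.inr (.inr (.inr ⟨h, hh, c, hb, z, hz, rfl, rfl, rfl⟩))) hyc h1).mono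
        (by linarith)
    -- Light edge: `y` itself becomes a target, where the listed port to `c` is taken.
    · refine ⟨y, RootedForest.self_mem_descendants _ _, portTo P y c + 1,
        ((h : ℕ) + 2, (shortestPathTree G w h).preorderNum z, k) :: ρ, ?_, ?_, ?_⟩
      · exact (h1.pop (.inr (.inr (.inl ⟨h, hh, rfl, rfl, rfl⟩))) hyc).mono (by linarith)
      · rw [RootedForest.mem_heavyChildren, not_and, not_lt] at hb
        rw [List.length_cons, pow_succ', mul_assoc, ← hk]
        exact (Nat.mul_le_mul_left b h2).trans (hb hc)
      · rintro e (_ | ⟨_, he⟩)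
        · exact ⟨by dsimp only; omega, hnum y, by have := portTo_le P y c; dsimp only; omega⟩
        · exact h3 e he

theorem exists_routes_root (hw : ∀ e ∈ G.edgeSet, 0 ≤ w e) {q : ℕ} {H : Finset (Fin n)} {b τ : ℕ}
    (hτ : ∀ t, b ^ t ≤ n → t ≤ τ) {h : Fin n} (hh : h ∈ H) {v x : Fin n}
    (hx : h ∈ vicinity G w q x) (hv : G.Reachable v h) :
    ∃ ρ, Routes w P (CoreRule w P q H b) v x ρ (weightedDist G w x h + weightedDist G w v h) ∧
      ρ.length ≤ τ + 2 ∧ ∀ e ∈ ρ, EntryLE (n + 1) e := by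
  have hh' := h.2
  by_cases hvh : v = h
  · subst hvh
    refine ⟨[(1, (v : ℕ), 0)], ?_, by simp, by simp [EntryLE]; omega⟩
    refine (routes_vicinity hw (Routes.deliver (.inl ⟨rfl, rfl, rfl⟩)) hx).mono ?_
    rw [weightedDist_self hw]
  · obtain ⟨c, hc, hvc⟩ := RootedForest.exists_child _ (mem_descendants_root hw hv) hvh
    obtain ⟨hyc, hd⟩ := isChild_shortestPathTree hw hc
    obtain ⟨z, hz, k, ρ, h1, h2, h3⟩ := exists_routes_tree (P := P) (q := q) (b := b) hw hh hvc
    -- The entry that leads to `h` also carries the port to the first child, whether heavy or not;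
    -- with the first tree entry this accounts for the `2` in `τ + 2`.
    refine ⟨(1, (h : ℕ), portTo P h c + 1) :: _, (routes_vicinity hw
      (Routes.pop (.inl ⟨rfl, rfl, rfl⟩) hyc h1) hx).mono ?_, ?_, ?_⟩
    · rw [weightedDist_self hw] at hd
      linarith
    · have h4 : 0 < ((shortestPathTree G w h).descendants v).card :=
        Finset.card_pos.2 ⟨v, RootedForest.self_mem_descendants _ _⟩
      have h5 : ((shortestPathTree G w h).descendants c).card ≤ n := by
        simpa using Finset.card_le_univ ((shortestPathTree G w h).descendants c)
      have := hτ _ ((Nat.le_mul_of_pos_right _ h4).trans (h2.trans h5))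
      simp only [List.length_cons]
      omega
    · rintro e (_ | ⟨_, he⟩)
      · exact ⟨by dsimp only; omega, by dsimp only; omega,
          by have := portTo_le P h c; dsimp only; omega⟩
      · exact h3 e he

/-- Either `v` can be reached from `x` with an additive error of `2 * δ`, or `v` is farther away than
`K * δ`. -/
theorem exists_routes_or (hw : ∀ e ∈ G.edgeSet, 0 ≤ w e) {q : ℕ} {H : Finset (Fin n)} {b τ : ℕ}
    (hτ : ∀ t, b ^ t ≤ n → t ≤ τ)
    (hH : ∀ x v, G.Reachable x v → v ∉ vicinity G w q x → ∃ h ∈ H, h ∈ vicinity G w q x)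
    {δ : ℝ} (hδ : 0 ≤ δ) {v : Fin n} (K : ℕ) {x : Fin n} (hr : G.Reachable x v) :
    (∃ ρ, Routes w P (CoreRule w P q H b) v x ρ (weightedDist G w x v + 2 * δ) ∧
      ρ.length ≤ K + τ + 2 ∧ ∀ e ∈ ρ, EntryLE (n + 1) e) ∨
    (K * δ ≤ weightedDist G w x v ∧ (0 < K → K * δ < weightedDist G w x v)) := by
  -- Each exit from a vicinity costs one header entry and gains more than `δ`. The bound is strict
  -- only once a step has been made, hence the clause `0 < K`.
  induction K generalizing x with
  | zero => right; simpa using weightedDist_nonneg hw x v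
  | succ K ih =>
  have hv' := v.2
  by_cases hv : v ∈ vicinity G w q x
  · left
    refine ⟨[(1, (v : ℕ), 0)], ?_, by simp, by simp [EntryLE]; omega⟩
    exact (routes_vicinity hw (Routes.deliver (.inl ⟨rfl, rfl, rfl⟩)) hv).mono (by linarith)
  · obtain ⟨h, hh, hhx⟩ := hH x v hr hv
    have hxh : G.Reachable x h := by classical exact (mem_vicinity.1 hhx).1
    rcases le_or_gt (weightedDist G w x h) δ with hle | hlt
    · left
      obtain ⟨ρ, h1, h2, h3⟩ := exists_routes_root (P := P) hw hτ hh hhx (hr.symm.trans hxh)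
      have h4 := weightedDist_triangle hw hr.symm hxh
      rw [weightedDist_comm G w v x] at h4
      exact ⟨ρ, h1.mono (by linarith), by omega, h3⟩
    -- With edges of weight zero, ties by name can push `x` out of its own vicinity; here `d(x,h) >
    -- δ ≥ 0` excludes this.
    · have hx : x ∈ vicinity G w q x :=
        mem_vicinity_of_closer hhx (.refl x) (.inl (by rw [weightedDist_self hw]; linarith))
      obtain ⟨y, x', hy, hyx', hx', hd⟩ := exists_exit_edge hw hx hv hr
      have hxy : G.Reachable x y := by classical exact (mem_vicinity.1 hy).1
      have hxx' : G.Reachable x x' := hxy.trans hyx'.reachable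
      rcases ih (hxx'.symm.trans hr) with ⟨ρ, h1, h2, h3⟩ | ⟨h1, -⟩
      · left
        refine ⟨(1, (y : ℕ), portTo P y x' + 1) :: ρ, (routes_vicinity hw
          (Routes.pop (.inl ⟨rfl, rfl, rfl⟩) hyx' h1) hy).mono (by linarith), ?_, ?_⟩
        · simp only [List.length_cons]
          omega
        · have := y.2
          rintro e (_ | ⟨_, he⟩)
          · exact ⟨by dsimp only; omega, by dsimp only; omega,
              by have := portTo_le P y x'; dsimp only; omega⟩
          · exact h3 e he
      · right
        -- As `x'` is outside the vicinity and `h` inside, `d(x,x') ≥ d(x,h) > δ`.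
        have h2 := weightedDist_le_of_mem_of_notMem hhx hx' hxx'
        have h3 := weightedDist_triangle hw hxy hyx'.reachable
        have h4 := weightedDist_le_of_adj hw hyx'
        push_cast
        have h5 : (K + 1) * δ < weightedDist G w x v := by linarith
        exact ⟨h5.le, fun _ => h5⟩

theorem exists_routes (hw : ∀ e ∈ G.edgeSet, 0 ≤ w e) {q : ℕ} {H : Finset (Fin n)} {b τ : ℕ}
    (hτ : ∀ t, b ^ t ≤ n → t ≤ τ)
    (hH : ∀ x v, G.Reachable x v → v ∉ vicinity G w q x → ∃ h ∈ H, h ∈ vicinity G w q x)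
    {ε : ℝ} (hε : 0 < ε) {K : ℕ} (hK : 2 ≤ K * ε) {x v : Fin n} (hr : G.Reachable x v) :
    ∃ ρ, Routes w P (CoreRule w P q H b) v x ρ ((1 + ε) * weightedDist G w x v) ∧
      ρ.length ≤ K + τ + 2 ∧ ∀ e ∈ ρ, EntryLE (n + 1) e := by
  have hd := weightedDist_nonneg hw x v
  -- This `δ` makes the error `2 * δ` equal to `ε d(x,v)`, and `K * δ ≥ d(x,v)` contradicts the
  -- strict bound of the second alternative.
  rcases exists_routes_or (P := P) hw hτ hH (δ := ε * weightedDist G w x v / 2) (by positivity) K hr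
    with ⟨ρ, h1, h2⟩ | ⟨-, h1⟩
  · exact ⟨ρ, h1.mono (by linarith), h2⟩
  · have hK0 : 0 < K := by
      rcases Nat.eq_zero_or_pos K with rfl | h
      · norm_num at hK
      · exact h
    have h2 := h1 hK0
    have h3 := mul_le_mul_of_nonneg_right hK hd
    linarith

/-- Routing tables whose rows are those of `coreRows` and an initial header for each vertex of
`S u`. -/
theorem exists_routing_tables (hw : ∀ e ∈ G.edgeSet, 0 ≤ w e) (P : PortNumbering G) {q : ℕ}
    {H : Finset (Fin n)} {b τ : ℕ} (hτ : ∀ t, b ^ t ≤ n → t ≤ τ)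
    (hH : ∀ x v, G.Reachable x v → v ∉ vicinity G w q x → ∃ h ∈ H, h ∈ vicinity G w q x)
    {ε : ℝ} (hε : 0 < ε) {K : ℕ} (hK : 2 ≤ K * ε) (S : Fin n → Finset (Fin n)) {L M : ℕ}
    (hL : L = 2 * (n + 1).size + 1) (hM : M = (K + τ + 2) * (3 * L)) :
    ∃ T : Fin n → List Bool,
      (∀ u, (T u).length ≤ (q + 1 + H.card * (b + 1)) * (8 * L + 3) +
        (S u).card * (8 * L + 4 * M + 3)) ∧
      ∀ u, ∀ v ∈ S u, G.Reachable u v → ∀ B : ℝ, M ≤ B → ∃ p : G.Walk u v,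
        Delivers tableForwarding P T B v [] p ∧
          walkWeight w p ≤ (1 + ε) * weightedDist G w u v := by
  classical
  have hρ : ∀ u v, ∃ ρ, G.Reachable u v →
      Routes w P (CoreRule w P q H b) v u ρ ((1 + ε) * weightedDist G w u v) ∧
      (encodeRoute ρ).length ≤ M := by
    intro u v
    by_cases hr : G.Reachable u v
    · obtain ⟨ρ, h1, h2, h3⟩ := exists_routes (P := P) hw hτ hH hε hK hr
      refine ⟨ρ, fun _ => ⟨h1, ?_⟩⟩
      rw [hM, hL]
      exact (length_encodeRoute_le h3).trans (Nat.mul_le_mul_right _ h2)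
    · exact ⟨[], fun h => absurd h hr⟩
  choose ρ hρ using hρ
  set R₀ : Fin n → Finset (ℕ × ℕ × ℕ × ℕ × List Bool) := fun u =>
    ((S u).filter (G.Reachable u)).image fun v : Fin n => (0, (v : ℕ), (v : ℕ), 0, encodeRoute (ρ u v))
    with hR₀
  have hmem₀ : ∀ u r, r ∈ R₀ u ↔ ∃ v ∈ S u, G.Reachable u v ∧
      r = (0, (v : ℕ), (v : ℕ), 0, encodeRoute (ρ u v)) := by
    intro u r
    simp only [hR₀, Finset.mem_image, Finset.mem_filter, and_assoc, eq_comm (a := r)]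
  set R : Fin n → Finset (ℕ × ℕ × ℕ × ℕ × List Bool) := fun u =>
    coreRows w P q H b u ∪ R₀ u with hR
  have hmem : ∀ u r, r ∈ (R u).toList ↔ r ∈ coreRows w P q H b u ∨ r ∈ R₀ u := by
    simp [hR]
  refine ⟨fun u => encodeTable (R u).toList, fun u => ?_, fun u v hv hr B hB => ?_⟩
  · refine (length_encodeTable_le (N := n + 1) fun r hr => ?_).trans ?_
    · rcases (hmem u r).1 hr with h | h
      · have := coreRows_le h
        exact ⟨this.2.1, this.2.2.1, this.2.2.2.1, this.2.2.2.2.1⟩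
      · obtain ⟨v, -, -, rfl⟩ := (hmem₀ u r).1 h
        have := v.2
        refine ⟨?_, ?_, ?_, ?_⟩ <;> dsimp only <;> omega
    -- A row holds four numbers of code length `L` and a header, and is itself coded as a word: `2 *
    -- (4 * L + (2 * M + 1)) + 1` bits, with `0` for `M` in core rows.
    · rw [Finset.sum_map_toList, ← hL]
      refine (Nat.le_of_add_right_le (Finset.sum_union_inter).le).trans (Nat.add_le_add ?_ ?_)
      · refine (Finset.sum_le_card_nsmul _ _ (8 * L + 3) fun r hr => ?_).trans ?_
        · rw [(coreRows_le hr).2.2.2.2.2]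
          simp
          omega
        · exact Nat.mul_le_mul_right _ (card_coreRows_le _ _ _ _)
      · refine (Finset.sum_le_card_nsmul _ _ (8 * L + 4 * M + 3) fun r hr => ?_).trans ?_
        · obtain ⟨v, -, h1, rfl⟩ := (hmem₀ u r).1 hr
          have := (hρ u v h1).2
          dsimp only
          omega
        · exact Nat.mul_le_mul_right _ (Finset.card_image_le.trans (Finset.card_filter_le _ _))
  · have hreal : Realizes (CoreRule w P q H b) fun u => encodeTable (R u).toList := by
      intro y c m p hc
      obtain ⟨r, hr, hrm⟩ := hc.exists_row
      obtain ⟨r', hr', hrm', hl⟩ := exists_lookupRow_encodeTable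
        ⟨r, (hmem y r).2 (.inl hr), hrm⟩
      refine ⟨_, hl, ?_⟩
      rcases (hmem y r').1 hr' with h | h
      · simpa [fieldValue, rowWords] using hc.action_eq h hrm'
      -- Initial headers have class `0`, core rows have class at least `1`.
      · obtain ⟨v', -, -, rfl⟩ := (hmem₀ y r').1 h
        have h1 := (coreRows_le hr).1
        have h2 := hrm.1
        have h3 := hrm'.1
        dsimp only at h3
        omega
    obtain ⟨h1, h2⟩ := hρ u v hr
    obtain ⟨p, hp, hpw⟩ := h1 _ hreal B (le_trans (by exact_mod_cast h2) hB)
    refine ⟨p, hp.of_header_eq ?_, hpw⟩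
    obtain ⟨r, hr', hrm, hl⟩ := exists_lookupRow_encodeTable (R := (R u).toList) (c := 0) (m := v)
      ⟨_, (hmem u _).2 (.inr ((hmem₀ u _).2 ⟨v, hv, hr, rfl⟩)), rfl, le_rfl, le_rfl⟩
    have hrv : r.2.2.2.2 = encodeRoute (ρ u v) := by
      rcases (hmem u r).1 hr' with h | h
      · have h1 := (coreRows_le h).1
        have h2 := hrm.1
        omega
      · obtain ⟨v', -, -, rfl⟩ := (hmem₀ u r).1 h
        rw [show v' = v from Fin.ext (le_antisymm hrm.2.1 hrm.2.2)]
    have he : effectiveHeader (encodeTable (R u).toList) v [] = encodeRoute (ρ u v) := by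
      simp [effectiveHeader, hl, rowWords, hrv]
    -- The empty header triggers the lookup of the stored one, so both give the same first action.
    by_cases hnil : encodeRoute (ρ u v) = []
    · rw [hnil]
    · rw [tableForwarding_of_ne_nil _ _ hnil]
      simp only [tableForwarding, he]

end Routing

/-! ### Numerical estimates -/

theorem one_lt_log_natCast {n : ℕ} (hn : 3 ≤ n) : 1 < Real.log n := by
  have hn' : (3 : ℝ) ≤ n := by exact_mod_cast hn
  rw [Real.lt_log_iff_exp_lt (by linarith)]
  have := Real.exp_one_lt_d9
  linarith

theorem size_succ_le {n : ℕ} (hn : 3 ≤ n) : ((n + 1).size : ℝ) ≤ 1 + 3 * Real.log n := by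
  have hn' : (3 : ℝ) ≤ n := by exact_mod_cast hn
  have hpos : 0 < (n + 1).size := Nat.size_pos.2 (Nat.succ_pos n)
  have h1 : 2 ^ ((n + 1).size - 1) ≤ n + 1 := Nat.lt_size.1 (by omega)
  -- From `n + 1 ≤ n ^ 2` the size is at most `1 + 2 log n / log 2`, and `2 / log 2 < 3`.
  have h2 : (2 : ℝ) ^ ((n + 1).size - 1) ≤ (n : ℝ) ^ 2 := by
    have : (2 : ℝ) ^ ((n + 1).size - 1) ≤ (n : ℝ) + 1 := by exact_mod_cast h1
    nlinarith
  have h3 := Real.log_le_log (by positivity) h2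
  rw [Real.log_pow, Real.log_pow, Nat.cast_sub hpos] at h3
  push_cast at h3
  have h4 := Real.log_two_gt_d9
  have h5 : (1 : ℝ) ≤ (n + 1).size := by exact_mod_cast hpos
  nlinarith

/-- With `b = ⌈log n⌉`, heavy children cost the tables only one logarithmic factor, while the number
of light edges drops to `log n / log log n`. -/
theorem le_floor_of_ceil_pow_le {n : ℕ} (hn : 3 ≤ n) (t : ℕ) (ht : ⌈Real.log n⌉₊ ^ t ≤ n) :
    t ≤ ⌊Real.log n / Real.log (Real.log n)⌋₊ := by
  have hl := one_lt_log_natCast hn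
  have hll := Real.log_pos hl
  refine Nat.le_floor ?_
  rw [le_div_iff₀ hll, ← Real.log_pow]
  refine Real.log_le_log (by positivity) ?_
  calc Real.log n ^ t ≤ (⌈Real.log n⌉₊ : ℝ) ^ t := pow_le_pow_left₀ (by linarith) (Nat.le_ceil _) t
    _ ≤ n := by exact_mod_cast ht

theorem header_bound {l l' ε L M : ℝ} {K τ : ℕ} (hl : 1 < l) (hl' : 0 < l') (hll : l' ≤ l)
    (hε : 0 < ε) (hL : L ≤ 9 * l) (hK : (K : ℝ) ≤ 2 / ε + 1) (hτ : (τ : ℝ) ≤ l / l')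
    (hM : M = (K + τ + 2) * (3 * L)) : M ≤ 108 * (1 / ε * l + l ^ 2 / l') := by
  have h1 : 1 ≤ l / l' := (one_le_div hl').2 hll
  have h2 : (K : ℝ) + τ + 2 ≤ 4 * (1 / ε) + 4 * (l / l') := by
    have h3 : 2 / ε = 2 * (1 / ε) := by ring
    have h4 : 0 < 1 / ε := by positivity
    linarith
  calc M = (K + τ + 2) * (3 * L) := hM
    _ ≤ (K + τ + 2) * (27 * l) := mul_le_mul_of_nonneg_left (by linarith) (by positivity)
    _ ≤ (4 * (1 / ε) + 4 * (l / l')) * (27 * l) := mul_le_mul_of_nonneg_right h2 (by linarith)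
    _ = _ := by ring

theorem table_bound {l X D r q L M s hc b C₀ : ℝ} {a₀ : ℕ} (hl : 1 < l) (hX : 1 ≤ X) (hD : 0 < D)
    (hr : 1 ≤ r) (hq : 1 ≤ q) (hL : L ≤ 9 * l) (hL0 : 0 ≤ L) (hM : M ≤ 108 * (X * l + D * l ^ 2))
    (hs0 : 0 ≤ s) (hs : s ≤ C₀ * r * l ^ a₀) (hh : hc ≤ r * l + 2) (hb0 : 0 ≤ b)
    (hb : b ≤ l + 1) :
    (q + 1 + hc * (b + 1)) * (8 * L + 3) + s * (8 * L + 4 * M + 3) ≤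
      (675 + 507 * |C₀| * (1 + D)) * (X * r + q) * l ^ (a₀ + 3) := by
  have hl2 : l ≤ l ^ 2 := by nlinarith
  have hpow : 1 ≤ l ^ a₀ := one_le_pow₀ hl.le
  have hrl : 1 ≤ r * l := by nlinarith
  have e1 : 8 * L + 3 ≤ 75 * l := by linarith
  have e2 : hc * (b + 1) ≤ 9 * r * l ^ 2 := by
    calc hc * (b + 1) ≤ (3 * (r * l)) * (b + 1) :=
          mul_le_mul_of_nonneg_right (by linarith) (by linarith)
      _ ≤ (3 * (r * l)) * (3 * l) := mul_le_mul_of_nonneg_left (by linarith) (by linarith)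
      _ = _ := by ring
  have hXr : r ≤ X * r := by nlinarith
  have e3 : q + 1 + hc * (b + 1) ≤ 9 * (X * r + q) * l ^ 2 := by
    have : q ≤ q * l ^ 2 := by nlinarith
    have : r * l ^ 2 ≤ X * r * l ^ 2 := mul_le_mul_of_nonneg_right hXr (by positivity)
    nlinarith
  have hpos : 0 ≤ X * r + q := by nlinarith
  have e4 : (q + 1 + hc * (b + 1)) * (8 * L + 3) ≤ 675 * (X * r + q) * l ^ (a₀ + 3) := by
    calc (q + 1 + hc * (b + 1)) * (8 * L + 3) ≤ (9 * (X * r + q) * l ^ 2) * (8 * L + 3) :=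
          mul_le_mul_of_nonneg_right e3 (by linarith)
      _ ≤ (9 * (X * r + q) * l ^ 2) * (75 * l) :=
          mul_le_mul_of_nonneg_left e1 (by positivity)
      _ = 675 * (X * r + q) * l ^ 3 * 1 := by ring
      _ ≤ 675 * (X * r + q) * l ^ 3 * l ^ a₀ :=
          mul_le_mul_of_nonneg_left hpow (by positivity)
      _ = _ := by ring
  -- The constant is `507 = 8 * 9 + 4 * 108 + 3`.
  have e5 : 8 * L + 4 * M + 3 ≤ 507 * (1 + D) * X * l ^ 2 := by
    have h1 : X * l ≤ X * l ^ 2 := mul_le_mul_of_nonneg_left hl2 (by linarith)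
    have h2 : D * l ^ 2 ≤ D * X * l ^ 2 :=
      mul_le_mul_of_nonneg_right (by nlinarith) (by positivity)
    have h3 : l ^ 2 ≤ X * l ^ 2 := by nlinarith [sq_nonneg l]
    have h4 : 0 ≤ D * X * l ^ 2 := by positivity
    nlinarith
  have e6 : s ≤ |C₀| * r * l ^ a₀ := hs.trans (by gcongr; exact le_abs_self _)
  have e7 : s * (8 * L + 4 * M + 3) ≤ 507 * |C₀| * (1 + D) * (X * r + q) * l ^ (a₀ + 3) := by
    calc s * (8 * L + 4 * M + 3) ≤ s * (507 * (1 + D) * X * l ^ 2) :=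
          mul_le_mul_of_nonneg_left e5 hs0
      _ ≤ (|C₀| * r * l ^ a₀) * (507 * (1 + D) * X * l ^ 2) :=
          mul_le_mul_of_nonneg_right e6 (by positivity)
      _ = (507 * |C₀| * (1 + D)) * (X * r) * l ^ (a₀ + 2) := by ring
      _ ≤ (507 * |C₀| * (1 + D)) * (X * r + q) * l ^ (a₀ + 3) := by
          have : l ^ (a₀ + 2) ≤ l ^ (a₀ + 3) := pow_le_pow_right₀ hl.le (by omega)
          have : X * r ≤ X * r + q := by linarith
          gcongr
  linarith

/-! ### Choice of the parameters -/

theorem mainTheorem7 :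
    ∃ A : ForwardingAlgorithm, Computable A ∧
    ∃ Ch : ℝ, ∀ (C₀ : ℝ) (a₀ : ℕ), ∃ (C : ℝ) (a : ℕ),
    ∀ (n : ℕ) (_ : 3 ≤ n) (G : SimpleGraph (Fin n)) (w : Sym2 (Fin n) → ℝ)
      (_ : ∀ e ∈ G.edgeSet, 0 ≤ w e) (P : PortNumbering G)
      (q : ℕ) (U : Finpartition (Finset.univ : Finset (Fin n))) (_ : U.parts.card = q)
      (_ : ∀ S ∈ U.parts, (S.card : ℝ) ≤ C₀ * ((n : ℝ) / q) * Real.log n ^ a₀)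
      (ε : ℝ) (_ : 0 < ε),
    ∃ T : Fin n → List Bool,
      (∀ u, ((T u).length : ℝ) ≤
        C * (max 1 (1 / ε) * ((n : ℝ) / q) + q) * Real.log n ^ a) ∧
      ∀ S ∈ U.parts, ∀ u ∈ S, ∀ v ∈ S, G.Reachable u v →
        ∃ p : G.Walk u v,
          Delivers A P T
            (Ch * (1 / ε * Real.log n + Real.log n ^ 2 / Real.log (Real.log n))) v [] p ∧
          walkWeight w p ≤ (1 + ε) * weightedDist G w u v := by
  classical
  -- For `n ≥ 3` the factor `1 / log log n` is largest at `n = 3`; this absorbs it into the constant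
  -- of the table bound.
  refine ⟨tableForwarding, computable_tableForwarding, 108, fun C₀ a₀ =>
    ⟨675 + 507 * |C₀| * (1 + 1 / Real.log (Real.log (3 : ℕ))), a₀ + 3, ?_⟩⟩
  intro n hn G w hw P q U hq hU ε hε
  have hl := one_lt_log_natCast hn
  have hll := Real.log_pos hl
  have hn0 : (0 : ℝ) < n := by exact_mod_cast (by omega : 0 < n)
  have hq0 : 0 < q := by
    rw [← hq, Finset.card_pos]
    exact ⟨_, U.part_mem.2 (Finset.mem_univ (⟨0, by omega⟩ : Fin n))⟩
  have hq1 : (1 : ℝ) ≤ q := by exact_mod_cast hq0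
  have hqn : q ≤ n := by
    rw [← hq]
    simpa using U.card_parts_le_card
  have hr : 1 ≤ (n : ℝ) / q := by
    rw [one_le_div (by linarith)]
    exact_mod_cast hqn
  obtain ⟨H, hHc, hH⟩ := exists_hitting_set (by omega : 0 < n) hq0
    (Finset.univ.filter fun x => ∃ v, G.Reachable x v ∧ v ∉ vicinity G w q x) (vicinity G w q)
    (fun x hx => by
      obtain ⟨v, h1, h2⟩ := (Finset.mem_filter.1 hx).2
      exact (card_vicinity_of_notMem h1 h2).ge)
  have hK : 2 ≤ (⌈2 / ε⌉₊ : ℝ) * ε := (div_le_iff₀ hε).1 (Nat.le_ceil _)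
  -- The bound on powers fixes `b = ⌈log n⌉₊` and `τ = ⌊log n / log log n⌋₊`; `hK` fixes `K = ⌈2 /
  -- ε⌉₊`. Each vertex stores initial headers for its own part.
  obtain ⟨T, hT, hT'⟩ := exists_routing_tables hw P (le_floor_of_ceil_pow_le hn)
    (fun x v h1 h2 => hH x (Finset.mem_filter.2 ⟨Finset.mem_univ x, v, h1, h2⟩)) hε hK U.part
    rfl rfl
  have hL : ((2 * (n + 1).size + 1 : ℕ) : ℝ) ≤ 9 * Real.log n := by
    have := size_succ_le hn
    push_cast
    linarith
  have hM := header_bound hl hll ((Real.log_le_self (by linarith))) hε hL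
    (Nat.ceil_lt_add_one (by positivity : 0 ≤ 2 / ε)).le
    (Nat.floor_le (by positivity : 0 ≤ Real.log n / Real.log (Real.log n))) rfl
  have hD : 1 / Real.log (Real.log n) ≤ 1 / Real.log (Real.log (3 : ℕ)) := by
    have h3 := one_lt_log_natCast le_rfl
    refine one_div_le_one_div_of_le (Real.log_pos h3) (Real.log_le_log (by linarith) ?_)
    exact Real.log_le_log (by norm_num) (by exact_mod_cast hn)
  refine ⟨T, fun u => ?_, fun S hS u hu v hv huv => ?_⟩
  · have h1 : ((T u).length : ℝ) ≤ _ := Nat.cast_le.2 (hT u)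
    push_cast at h1 hM hL
    refine h1.trans (table_bound hl (le_max_left 1 (1 / ε))
      (one_div_pos.2 (Real.log_pos (one_lt_log_natCast le_rfl))) hr hq1 hL (by positivity)
      (hM.trans ?_) (by positivity) (hU _ (U.part_mem.2 (Finset.mem_univ u))) hHc (by positivity)
      (Nat.ceil_lt_add_one (by linarith)).le)
    have h2 : 1 / ε * Real.log n ≤ max 1 (1 / ε) * Real.log n :=
      mul_le_mul_of_nonneg_right (le_max_right _ _) (by linarith)
    have h3 : Real.log n ^ 2 / Real.log (Real.log n) ≤
        1 / Real.log (Real.log (3 : ℕ)) * Real.log n ^ 2 := by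
      rw [div_eq_mul_one_div, mul_comm]
      exact mul_le_mul_of_nonneg_right hD (by positivity)
    linarith
  · obtain ⟨p, hp, hpw⟩ := hT' u v (by rw [U.part_eq_of_mem hS hu]; exact hv) huv _
      (le_trans (by push_cast; exact le_rfl) hM)
    exact ⟨p, hp, hpw⟩
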